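/- **Setting.** There are $n\ge 1$ agents and a set $M$ of $m$ indivisible goods. Agent $i$ has an additive valuation $v_i:2^M\to\mathbb R_{\ge 0}$, i.e. $v_i(S)=\sum_{g\in S}v_i(\{g\})$. A partial allocation is a family $X=\langle X_1,\dots,X_n\rangle$ of pairwise disjoint subsets of $M$; its set of unallocated goods is $P=M\setminus\bigcup_i X_i$. For $\alpha\in(0,1]$, $X$ is $\alpha$-EFX if $v_i(X_i)\ge\alpha\cdot v_i(X_j\setminus\{g\})$ for all agents $i,j$ and all $g\in X_j$. **Machine model.** An algorithm is a fixed random access program with arrays of natural numbers and arrays of real numbers, all of which are zero at the start. In one step it can read or write a cell whose address has been computed, access $n$, $m$, $\varepsilon$ or one value $v_i(\{g\})$, use a constant natural number, add or subtract two numbers (subtraction of natural numbers being truncated at $0$), multiply a real number by $\varepsilon$, compare two numbers, or perform a logical operation (negation, conjunction) in a test. No other multiplication and no rounding is available. **Theorem.** There are one such program and constants $C,k\in\mathbb N$ such that the following holds for all $n\ge1$, all $m\ge 0$, all $\varepsilon\in(0,1/2]$, all additive valuations $v_1,\dots,v_n$ as above, and every real $W\ge 1$ such that $v_i(M)\le W\cdot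 v_i(\{g\})$ whenever $v_i(\{g\})>0$ (for integer valuations, $W=\max\{1,\max_i v_i(M)\}$ is such a number). On input $(n,m,v,\varepsilon)$ the program halts after at most $$C\,\bigl(n+m+\log_2 W+1/\varepsilon\bigr)^k$$ steps, and it outputs a partial allocation $X$ and its set $P$ of unallocated goods such that - $X$ is $(1-\varepsilon)$-EFX, and - $|P|\le 64\,(n/\varepsilon)^{4/5}$. -/

import Mathlib

namespace EFX

/-! ### Fair division with additive valuations -/

/-- A nonnegative additive valuation on the subsets of the set `Fin m` of goods. -/
def IsAdditiveValuation {m : ℕ} (v : Finset (Fin m) → ℝ) : Prop :=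
  (∀ S, 0 ≤ v S) ∧ ∀ S, v S = ∑ g ∈ S, v {g}

/-- A partial allocation: the bundles of different agents are disjoint. Goods may stay
unallocated. -/
def IsPartialAllocation {n m : ℕ} (X : Fin n → Finset (Fin m)) : Prop :=
  ∀ i j, i ≠ j → Disjoint (X i) (X j)

/-- The set of all goods that `X` gives to nobody. -/
def unallocated {n m : ℕ} (X : Fin n → Finset (Fin m)) : Finset (Fin m) :=
  Finset.univ \ Finset.univ.biUnion X

/-- `X` is `α`-EFX: `v_i(X_i) ≥ α * v_i(X_j \ {g})` for all agents `i`, `j` and all `g ∈ X_j`. -/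
def IsApproxEFX {n m : ℕ} (v : Fin n → Finset (Fin m) → ℝ) (α : ℝ)
    (X : Fin n → Finset (Fin m)) : Prop :=
  ∀ i j, ∀ g ∈ X j, α * v i (X j \ {g}) ≤ v i (X i)

/-! ### Random access programs over the reals, with a step count

Programs work on two kinds of cells, one holding natural numbers and one holding real numbers.
The cells of each kind form arrays with two indices; the indices may be computed at run time.
Every operation (reading or writing a cell, accessing a number of the input, addition,
subtraction, scaling a real number by `ε`, comparison) costs one step. There is no multiplication
and no rounding, so that a polynomial number of steps cannot create numbers of more than
polynomial length out of rational data. -/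

/-- The input of a program: the numbers of agents and of goods, the value of each single good to
each agent, and `ε`. -/
structure Input where
  numAgents : ℕ
  numGoods : ℕ
  value : ℕ → ℕ → ℝ
  eps : ℝ

/-- The memory: cell `(i, j)` of array number `a` is `nat a i j`, respectively `real a i j`. -/
structure Memory where
  nat : ℕ → ℕ → ℕ → ℕ
  real : ℕ → ℕ → ℕ → ℝ

/-- The memory at the start: every cell holds zero. -/
def Memory.init : Memory := ⟨fun _ _ _ => 0, fun _ _ _ => 0⟩

/-- Overwrite one cell that holds a natural number. -/
def Memory.setNat (s : Memory) (a i j x : ℕ) : Memory where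
  nat := fun a' i' j' => if a' = a ∧ i' = i ∧ j' = j then x else s.nat a' i' j'
  real := s.real

/-- Overwrite one cell that holds a real number. -/
noncomputable def Memory.setReal (s : Memory) (a i j : ℕ) (x : ℝ) : Memory where
  nat := s.nat
  real := fun a' i' j' => if a' = a ∧ i' = i ∧ j' = j then x else s.real a' i' j'

/-- Expressions for natural numbers. -/
inductive NExp where
  /-- a constant -/
  | lit (k : ℕ)
  /-- the number of agents -/
  | numAgents
  /-- the number of goods -/
  | numGoods
  /-- the content of cell `(i, j)` of array number `a` -/
  | read (a : ℕ) (i j : NExp)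
  | add (e f : NExp)
  /-- truncated subtraction -/
  | sub (e f : NExp)

/-- The value of an expression. -/
def NExp.eval (I : Input) (s : Memory) : NExp → ℕ
  | lit k => k
  | numAgents => I.numAgents
  | numGoods => I.numGoods
  | read a i j => s.nat a (i.eval I s) (j.eval I s)
  | add e f => e.eval I s + f.eval I s
  | sub e f => e.eval I s - f.eval I s

/-- The number of operations in an expression. -/
def NExp.cost : NExp → ℕ
  | lit _ => 1
  | numAgents => 1
  | numGoods => 1
  | read _ i j => i.cost + j.cost + 1
  | add e f => e.cost + f.cost + 1
  | sub e f => e.cost + f.cost + 1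

/-- Expressions for real numbers. -/
inductive RExp where
  /-- a constant natural number -/
  | lit (k : ℕ)
  /-- the number `ε` of the input -/
  | eps
  /-- the value of good number `g` to agent number `i` -/
  | value (i g : NExp)
  /-- the content of cell `(i, j)` of array number `a` -/
  | read (a : ℕ) (i j : NExp)
  | add (e f : RExp)
  | sub (e f : RExp)
  /-- multiplication by the number `ε` of the input -/
  | scale (e : RExp)

/-- The value of an expression. -/
noncomputable def RExp.eval (I : Input) (s : Memory) : RExp → ℝ
  | lit k => k
  | eps => I.eps
  | value i g => I.value (i.eval I s) (g.eval I s)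
  | read a i j => s.real a (i.eval I s) (j.eval I s)
  | add e f => e.eval I s + f.eval I s
  | sub e f => e.eval I s - f.eval I s
  | scale e => I.eps * e.eval I s

/-- The number of operations in an expression. -/
def RExp.cost : RExp → ℕ
  | lit _ => 1
  | eps => 1
  | value i g => i.cost + g.cost + 1
  | read _ i j => i.cost + j.cost + 1
  | add e f => e.cost + f.cost + 1
  | sub e f => e.cost + f.cost + 1
  | scale e => e.cost + 1

/-- Tests. -/
inductive Test where
  | ltNat (e f : NExp)
  | ltReal (e f : RExp)
  | neg (b : Test)
  | conj (b c : Test)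

/-- The truth value of a test. -/
def Test.Holds (I : Input) (s : Memory) : Test → Prop
  | ltNat e f => e.eval I s < f.eval I s
  | ltReal e f => e.eval I s < f.eval I s
  | neg b => ¬ b.Holds I s
  | conj b c => b.Holds I s ∧ c.Holds I s

/-- The number of operations in a test. -/
def Test.cost : Test → ℕ
  | ltNat e f => e.cost + f.cost + 1
  | ltReal e f => e.cost + f.cost + 1
  | neg b => b.cost + 1
  | conj b c => b.cost + c.cost + 1

/-- Programs. -/
inductive Prog where
  | skip
  /-- write the value of `e` into cell `(i, j)` of array number `a` of natural numbers -/
  | setNat (a : ℕ) (i j e : NExp)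
  /-- write the value of `e` into cell `(i, j)` of array number `a` of real numbers -/
  | setReal (a : ℕ) (i j : NExp) (e : RExp)
  | seq (c d : Prog)
  | ite (b : Test) (c d : Prog)
  /-- repeat `c` as long as `b` holds -/
  | loop (b : Test) (c : Prog)

/-- `Exec I c s t s'`: on input `I` the program `c`, started with memory `s`, halts after exactly
`t` steps with memory `s'`. -/
inductive Exec (I : Input) : Prog → Memory → ℕ → Memory → Prop where
  | skip (s : Memory) : Exec I Prog.skip s 1 s
  | setNat (s : Memory) (a : ℕ) (i j e : NExp) :
      Exec I (Prog.setNat a i j e) s (i.cost + j.cost + e.cost + 1)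
        (s.setNat a (i.eval I s) (j.eval I s) (e.eval I s))
  | setReal (s : Memory) (a : ℕ) (i j : NExp) (e : RExp) :
      Exec I (Prog.setReal a i j e) s (i.cost + j.cost + e.cost + 1)
        (s.setReal a (i.eval I s) (j.eval I s) (e.eval I s))
  | seq {c d : Prog} {s s' s'' : Memory} {t t' : ℕ} (hc : Exec I c s t s')
      (hd : Exec I d s' t' s'') : Exec I (Prog.seq c d) s (t + t') s''
  | ite_true {b : Test} {c d : Prog} {s s' : Memory} {t : ℕ} (hb : b.Holds I s)
      (hc : Exec I c s t s') : Exec I (Prog.ite b c d) s (b.cost + t) s'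
  | ite_false {b : Test} {c d : Prog} {s s' : Memory} {t : ℕ} (hb : ¬ b.Holds I s)
      (hd : Exec I d s t s') : Exec I (Prog.ite b c d) s (b.cost + t) s'
  | loop_stop {b : Test} {c : Prog} {s : Memory} (hb : ¬ b.Holds I s) :
      Exec I (Prog.loop b c) s b.cost s
  | loop_step {b : Test} {c : Prog} {s s' s'' : Memory} {t t' : ℕ} (hb : b.Holds I s)
      (hc : Exec I c s t s') (hl : Exec I (Prog.loop b c) s' t' s'') :
      Exec I (Prog.loop b c) s (b.cost + t + t') s''

/-! ### Input and output of an allocation algorithm -/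

open Classical in
/-- The input that describes the valuations `v` and the number `ε`. -/
noncomputable def instanceInput {n m : ℕ} (v : Fin n → Finset (Fin m) → ℝ) (ε : ℝ) : Input where
  numAgents := n
  numGoods := m
  value := fun i g => if h : i < n ∧ g < m then v ⟨i, h.1⟩ {⟨g, h.2⟩} else 0
  eps := ε

/-- The bundles that are read off the final memory: the cells `(i, g)` of array number `0` of
natural numbers are the indicator of `g ∈ X_i`. -/
def outputBundles (n m : ℕ) (s : Memory) : Fin n → Finset (Fin m) :=
  fun i => Finset.univ.filter fun g => s.nat 0 i g ≠ 0

/-- The set `P` that is read off the final memory: the cells `(0, g)` of array number `1` of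
natural numbers are its indicator. -/
def outputPool (m : ℕ) (s : Memory) : Finset (Fin m) :=
  Finset.univ.filter fun g => s.nat 1 0 g ≠ 0

end EFX

/-! The algorithm keeps a (1-ε)-EFX allocation `X`, at first empty, and improves it in rounds. Say
that `i` θ-envies `S` if v_i(X_i) < (1-θ) v_i(S). Suppose that somebody ε-envies the pool P.
Removing goods yields an inclusion-minimal ε-envied subset, which a champion, an agent envying it,
takes in exchange for its bundle (`Fair.swap`). Otherwise a pool good goes to a bundle if nobody
ε-envies the result (`Fair.add`).

If neither is possible, X_j ∪ {g} has a champion for every agent j and every pool good g. A map φ on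
the agents is then built greedily, with bundles B_j ⊆ X_j ∪ P that φ(j) (ε/2)-envies. If X_j itself
is (ε/2)-envied, it is B_j and goes to an envier. The remaining agents form U. Each pool good in
turn is given to the most popular champion t over U: every j in U whose champion is t leaves U, with
φ(j) = t and B_j a minimal envied subset of X_j ∪ {g}. A good thus serves only one taker, so bundles
with different takers are disjoint. If U becomes empty, φ is total and has a cycle. On the cycle φ
is injective, so its bundles can be handed over along it (`Fair.rotate`).

If U stays nonempty, the pool is small. A champion of X_j ∪ {g} with X_j not (ε/2)-envied must value
g above (ε/2) v_i(X_i) (`mem_valuers`). Let d_g count such agents. The good g shrinks U at least by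
the factor exp(-1/d_g), so 1 ≤ n exp(-Σ 1/d_g) and Σ 1/d_g ≤ log n. As nobody ε-envies the pool, Σ
d_g ≤ 4n/ε (`sum_card_valuers_le`). Cauchy–Schwarz gives |P|² ≤ (4n/ε) log n, which is stronger than
the claim (`card_pool_le`).

Nobody ever loses. In each nonfinal round some agent gains a factor above 1/(1-ε/2), which can
happen O(1 + log W / ε) times per agent, or the pool shrinks; a potential combines both
(`Progress.potential_add_one_le`). The rest verifies a program that performs these rounds
(`round_spec`, `exec_algorithm`). Only its outermost loop is not a counted loop, so each round has
polynomial cost. -/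

open Finset

namespace EFX

/-! ### Structured programs: all loops run over the agents or over the goods -/

/-- The range of a counted loop. -/
inductive Dim where
  | agents
  | goods

/-- The number of iterations of a counted loop. -/
def Dim.size (I : Input) : Dim → ℕ
  | agents => I.numAgents
  | goods => I.numGoods

/-- The expression for the number of iterations of a counted loop. -/
def Dim.toExp : Dim → NExp
  | agents => NExp.numAgents
  | goods => NExp.numGoods

theorem Dim.eval_toExp (I : Input) (s : Memory) (d : Dim) : d.toExp.eval I s = d.size I := by
  cases d <;> rfl

/-- Programs with counted loops only. The counter of a loop is the cell `(0, 0)` of its own array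
of natural numbers. -/
inductive SProg where
  | skip
  | setNat (a : ℕ) (i j e : NExp)
  | setReal (a : ℕ) (i j : NExp) (e : RExp)
  | seq (c d : SProg)
  | ite (b : Test) (c d : SProg)
  | count (a : ℕ) (d : Dim) (c : SProg)

namespace SProg

open Classical in
/-- The memory after the execution of a structured program. -/
noncomputable def sem (I : Input) : SProg → Memory → Memory
  | skip, s => s
  | setNat a i j e, s => s.setNat a (i.eval I s) (j.eval I s) (e.eval I s)
  | setReal a i j e, s => s.setReal a (i.eval I s) (j.eval I s) (e.eval I s)
  | seq c d, s => sem I d (sem I c s)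
  | ite b c d, s => if b.Holds I s then sem I c s else sem I d s
  | count a d c, s =>
      (Nat.rec s (fun k s' => sem I c (s'.setNat a 0 0 k)) (d.size I) : Memory).setNat a 0 0
        (d.size I)

/-- Whether the program writes into array number `x` of natural numbers. -/
def writesNat (x : ℕ) : SProg → Bool
  | skip => false
  | setNat a _ _ _ => a == x
  | setReal _ _ _ _ => false
  | seq c d => c.writesNat x || d.writesNat x
  | ite _ c d => c.writesNat x || d.writesNat x
  | count a _ c => a == x || c.writesNat x

/-- No loop body writes into the counter of its loop. -/
def wf : SProg → Bool
  | skip => true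
  | setNat _ _ _ _ => true
  | setReal _ _ _ _ => true
  | seq c d => c.wf && d.wf
  | ite _ c d => c.wf && d.wf
  | count a _ c => !c.writesNat a && c.wf

/-- Translation into a program of the machine model. -/
def compile : SProg → Prog
  | skip => .skip
  | setNat a i j e => .setNat a i j e
  | setReal a i j e => .setReal a i j e
  | seq c d => .seq c.compile d.compile
  | ite b c d => .ite b c.compile d.compile
  | count a d c =>
      .seq (.setNat a (.lit 0) (.lit 0) (.lit 0))
        (.loop (.ltNat (.read a (.lit 0) (.lit 0)) d.toExp)
          (.seq c.compile
            (.setNat a (.lit 0) (.lit 0) (.add (.read a (.lit 0) (.lit 0)) (.lit 1)))))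

/-- A bound for the number of steps if all loops have at most `N` iterations. -/
def cost (N : ℕ) : SProg → ℕ
  | skip => 1
  | setNat _ i j e => i.cost + j.cost + e.cost + 1
  | setReal _ i j e => i.cost + j.cost + e.cost + 1
  | seq c d => c.cost N + d.cost N
  | ite b c d => b.cost + (c.cost N + d.cost N)
  | count _ _ c => 9 + N * (c.cost N + 13)

/-- A counted loop raises the degree by one. Sequencing adds the degrees, which is wasteful but
harmless for a fixed program. The base `N + 1` keeps powers monotone in the exponent when `N = 0`.
-/
theorem cost_le_pow (c : SProg) : ∃ C k : ℕ, ∀ N, c.cost N ≤ C * (N + 1) ^ k := by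
  induction c with
  | skip => exact ⟨1, 0, fun N => by simp [cost]⟩
  | setNat a i j e => exact ⟨i.cost + j.cost + e.cost + 1, 0, fun N => by simp [cost]⟩
  | setReal a i j e => exact ⟨i.cost + j.cost + e.cost + 1, 0, fun N => by simp [cost]⟩
  | seq c d hc hd =>
    obtain ⟨C, k, h⟩ := hc
    obtain ⟨D, l, h'⟩ := hd
    refine ⟨C + D, k + l, fun N => ?_⟩
    have h1 : (N + 1) ^ k ≤ (N + 1) ^ (k + l) := Nat.pow_le_pow_right (by omega) (by omega)
    have h2 : (N + 1) ^ l ≤ (N + 1) ^ (k + l) := Nat.pow_le_pow_right (by omega) (by omega)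
    calc c.cost N + d.cost N ≤ C * (N + 1) ^ k + D * (N + 1) ^ l := add_le_add (h N) (h' N)
      _ ≤ C * (N + 1) ^ (k + l) + D * (N + 1) ^ (k + l) := by gcongr
      _ = _ := by ring
  | ite b c d hc hd =>
    obtain ⟨C, k, h⟩ := hc
    obtain ⟨D, l, h'⟩ := hd
    refine ⟨b.cost + (C + D), k + l, fun N => ?_⟩
    have h0 : 1 ≤ (N + 1) ^ (k + l) := Nat.one_le_pow _ _ (by omega)
    have h1 : (N + 1) ^ k ≤ (N + 1) ^ (k + l) := Nat.pow_le_pow_right (by omega) (by omega)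
    have h2 : (N + 1) ^ l ≤ (N + 1) ^ (k + l) := Nat.pow_le_pow_right (by omega) (by omega)
    calc b.cost + (c.cost N + d.cost N)
        ≤ b.cost * 1 + (C * (N + 1) ^ k + D * (N + 1) ^ l) := by
          rw [mul_one]; exact add_le_add le_rfl (add_le_add (h N) (h' N))
      _ ≤ b.cost * (N + 1) ^ (k + l) + (C * (N + 1) ^ (k + l) + D * (N + 1) ^ (k + l)) := by
          gcongr
      _ = _ := by ring
  | count a d c hc =>
    obtain ⟨C, k, h⟩ := hc
    refine ⟨9 + (C + 13), k + 1, fun N => ?_⟩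
    have h0 : 1 ≤ (N + 1) ^ k := Nat.one_le_pow _ _ (by omega)
    have h1 : 1 ≤ (N + 1) ^ (k + 1) := Nat.one_le_pow _ _ (by omega)
    calc 9 + N * (c.cost N + 13) ≤ 9 * 1 + (N + 1) * (C * (N + 1) ^ k + 13 * 1) := by
          gcongr
          · omega
          · exact h N
      _ ≤ 9 * (N + 1) ^ (k + 1) + (N + 1) * (C * (N + 1) ^ k + 13 * (N + 1) ^ k) := by gcongr
      _ = _ := by ring

/-! ### Memory updates, and correctness of the translation into the machine model -/

@[simp] theorem nat_setNat (s : Memory) (a i j x a' i' j' : ℕ) :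
    (s.setNat a i j x).nat a' i' j' =
      if a' = a ∧ i' = i ∧ j' = j then x else s.nat a' i' j' := rfl

@[simp] theorem real_setNat (s : Memory) (a i j x : ℕ) : (s.setNat a i j x).real = s.real := rfl

@[simp] theorem nat_setReal (s : Memory) (a i j : ℕ) (x : ℝ) :
    (s.setReal a i j x).nat = s.nat := rfl

@[simp] theorem real_setReal (s : Memory) (a i j : ℕ) (x : ℝ) (a' i' j' : ℕ) :
    (s.setReal a i j x).real a' i' j' =
      if a' = a ∧ i' = i ∧ j' = j then x else s.real a' i' j' := rfl

theorem nat_setNat_of_ne (s : Memory) {a a' : ℕ} (i j x : ℕ) (h : a ≠ a') :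
    (s.setNat a i j x).nat a' = s.nat a' := by
  funext i' j'
  simp [h.symm]

/-- A structured program changes only the arrays that it writes into. -/
theorem nat_sem_of_not_writes (I : Input) {x : ℕ} (c : SProg) (s : Memory)
    (h : c.writesNat x = false) : (c.sem I s).nat x = s.nat x := by
  induction c generalizing s with
  | skip => rfl
  | setNat a i j e =>
    exact nat_setNat_of_ne _ _ _ _ (by simpa [writesNat] using h)
  | setReal a i j e => rfl
  | seq c d hc hd =>
    simp only [writesNat, Bool.or_eq_false_iff] at h
    simp only [sem]
    rw [hd _ h.2, hc _ h.1]
  | ite b c d hc hd =>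
    simp only [writesNat, Bool.or_eq_false_iff] at h
    simp only [sem]
    split_ifs
    · exact hc _ h.1
    · exact hd _ h.2
  | count a d c hc =>
    simp only [writesNat, Bool.or_eq_false_iff, beq_eq_false_iff_ne] at h
    simp only [sem]
    rw [nat_setNat_of_ne _ _ _ _ h.1]
    generalize d.size I = N
    induction N with
    | zero => rfl
    | succ k ih =>
      simp only
      rw [hc _ h.2, nat_setNat_of_ne _ _ _ _ h.1, ih]

/-- By `wf`, the body of a loop leaves its counter alone, so the while loop makes exactly the
prescribed number of passes. -/
theorem exec_compile (I : Input) (N : ℕ) (hn : I.numAgents ≤ N) (hm : I.numGoods ≤ N)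
    (c : SProg) (hwf : c.wf = true) (s : Memory) :
    ∃ t, Exec I c.compile s t (c.sem I s) ∧ t ≤ c.cost N := by
  induction c generalizing s with
  | skip => exact ⟨_, .skip s, le_rfl⟩
  | setNat a i j e => exact ⟨_, .setNat s a i j e, le_rfl⟩
  | setReal a i j e => exact ⟨_, .setReal s a i j e, le_rfl⟩
  | seq c d hc hd =>
    simp only [wf, Bool.and_eq_true] at hwf
    obtain ⟨t, ht, hle⟩ := hc hwf.1 s
    obtain ⟨t', ht', hle'⟩ := hd hwf.2 (c.sem I s)
    exact ⟨_, .seq ht ht', add_le_add hle hle'⟩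
  | ite b c d hc hd =>
    simp only [wf, Bool.and_eq_true] at hwf
    by_cases hb : b.Holds I s
    · obtain ⟨t, ht, hle⟩ := hc hwf.1 s
      refine ⟨_, by simpa [sem, hb, compile] using Exec.ite_true hb ht, ?_⟩
      simp only [cost]; omega
    · obtain ⟨t, ht, hle⟩ := hd hwf.2 s
      refine ⟨_, by simpa [sem, hb, compile] using Exec.ite_false hb ht, ?_⟩
      simp only [cost]; omega
  | count a d c hc =>
    simp only [wf, Bool.and_eq_true, Bool.not_eq_true'] at hwf
    have hN : d.size I ≤ N := by cases d <;> assumption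
    set st : ℕ → Memory := fun k => Nat.rec s (fun k s' => c.sem I (s'.setNat a 0 0 k)) k with hst
    set b : Test := .ltNat (.read a (.lit 0) (.lit 0)) d.toExp with hb
    set body : Prog := .seq c.compile
      (.setNat a (.lit 0) (.lit 0) (.add (.read a (.lit 0) (.lit 0)) (.lit 1))) with hbody
    have hbc : b.cost = 5 := by cases d <;> rfl
    have hholds : ∀ k, b.Holds I ((st k).setNat a 0 0 k) ↔ k < d.size I := by
      intro k
      simp [hb, Test.Holds, NExp.eval, Dim.eval_toExp]
    -- Induction on the number `r` of remaining passes, because `Exec.loop_step` peels off the first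
    -- pass.
    have main : ∀ r k, k + r = d.size I → ∃ t, Exec I (.loop b body) ((st k).setNat a 0 0 k) t
        ((st (d.size I)).setNat a 0 0 (d.size I)) ∧ t ≤ 5 + r * (c.cost N + 13) := by
      intro r
      induction r with
      | zero =>
        intro k hk
        have hk' : k = d.size I := by omega
        subst hk'
        refine ⟨_, Exec.loop_stop (by rw [hholds]; omega), ?_⟩
        omega
      | succ r ih =>
        intro k hk
        obtain ⟨t, ht, hle⟩ := hc hwf.2 ((st k).setNat a 0 0 k)
        obtain ⟨t', ht', hle'⟩ := ih (k + 1) (by omega)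
        have hcnt : (c.sem I ((st k).setNat a 0 0 k)).nat a 0 0 = k := by
          rw [nat_sem_of_not_writes I c _ hwf.1]; simp
        have hset := Exec.setNat (I := I) (c.sem I ((st k).setNat a 0 0 k)) a (.lit 0) (.lit 0)
          (.add (.read a (.lit 0) (.lit 0)) (.lit 1))
        simp only [NExp.eval, hcnt] at hset
        refine ⟨_, Exec.loop_step ((hholds k).2 (by omega)) (Exec.seq ht hset) ht', ?_⟩
        -- A pass costs 13 beyond its body: 5 for the test and 8 for the increment. The 9 outside
        -- the passes is 4 for clearing the counter and 5 for the last, failing test.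
        simp only [NExp.cost, hbc]
        rw [Nat.succ_mul]
        omega
    obtain ⟨t, ht, hle⟩ := main (d.size I) 0 (by omega)
    refine ⟨_, Exec.seq (Exec.setNat s a (.lit 0) (.lit 0) (.lit 0)) ht, ?_⟩
    have := Nat.mul_le_mul_right (c.cost N + 13) hN
    simp only [NExp.cost, cost]
    omega

/-- Invariants of counted loops. -/
theorem count_induction {I : Input} {a : ℕ} {d : Dim} {c : SProg} {s s' : Memory} {P : Prop}
    (he : (count a d c).sem I s = s') (Q : ℕ → Memory → Prop) (h0 : Q 0 s)
    (hstep : ∀ k < d.size I, ∀ s, Q k s → Q (k + 1) (c.sem I (s.setNat a 0 0 k)))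
    (hP : ∀ s₁, Q (d.size I) s₁ → s' = s₁.setNat a 0 0 (d.size I) → P) : P := by
  refine hP _ ?_ he.symm
  have : ∀ k ≤ d.size I,
      Q k (Nat.rec s (fun k s' => c.sem I (s'.setNat a 0 0 k)) k : Memory) := by
    intro k
    induction k with
    | zero => intro _; exact h0
    | succ k ih => intro hk; exact hstep k (by omega) _ (ih (by omega))
  exact this _ le_rfl

end SProg

/-! ### Allocations with small envy -/

/-- The value of a set of goods to an agent. -/
noncomputable def Input.val (I : Input) (i : ℕ) (S : Finset ℕ) : ℝ := ∑ g ∈ S, I.value i g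

/-- The goods that `X` gives to nobody. -/
def Input.pool (I : Input) (X : ℕ → Finset ℕ) : Finset ℕ :=
  range I.numGoods \ (range I.numAgents).biUnion X

/-- Agent `i` prefers `S` to the own bundle by more than the factor `1 / (1 - θ)`. -/
def Envies (I : Input) (θ : ℝ) (X : ℕ → Finset ℕ) (i : ℕ) (S : Finset ℕ) : Prop :=
  I.val i (X i) < (1 - θ) * I.val i S

/-- The conditions on the input. -/
structure Input.Valid (I : Input) : Prop where
  value_nonneg : ∀ i g, 0 ≤ I.value i g
  eps_pos : 0 < I.eps
  eps_le : I.eps ≤ 1 / 2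
  agents_pos : 0 < I.numAgents

/-- Partial allocations that are approximately EFX. -/
structure Fair (I : Input) (X : ℕ → Finset ℕ) : Prop where
  sub : ∀ i < I.numAgents, X i ⊆ range I.numGoods
  disj : ∀ i < I.numAgents, ∀ j < I.numAgents, i ≠ j → Disjoint (X i) (X j)
  efx : ∀ i < I.numAgents, ∀ j < I.numAgents, ∀ g ∈ X j, ¬ Envies I I.eps X i ((X j).erase g)

/-- No agent loses, and either some agent gains substantially or the pool shrinks. -/
def Progress (I : Input) (X X' : ℕ → Finset ℕ) : Prop :=
  (∀ i < I.numAgents, I.val i (X i) ≤ I.val i (X' i)) ∧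
    ((∃ i < I.numAgents, Envies I (I.eps / 2) X i (X' i)) ∨
      (I.pool X').card < (I.pool X).card)

/-! ### Improvement steps that preserve approximate EFX -/

variable {I : Input} {X X' : ℕ → Finset ℕ}

theorem Input.Valid.val_nonneg (hI : I.Valid) (i : ℕ) (S : Finset ℕ) : 0 ≤ I.val i S :=
  sum_nonneg fun g _ => hI.value_nonneg i g

theorem Input.Valid.val_mono (hI : I.Valid) (i : ℕ) {S T : Finset ℕ} (h : S ⊆ T) :
    I.val i S ≤ I.val i T :=
  sum_le_sum_of_subset_of_nonneg h fun g _ _ => hI.value_nonneg i g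

theorem Envies.mono (hI : I.Valid) {θ : ℝ} (hθ : θ ≤ 1) {i : ℕ} {S T : Finset ℕ}
    (h : Envies I θ X i S) (hST : S ⊆ T) : Envies I θ X i T :=
  h.trans_le (mul_le_mul_of_nonneg_left (hI.val_mono i hST) (by linarith))

theorem Envies.of_le (hI : I.Valid) {θ θ' : ℝ} (hθ : θ' ≤ θ) {i : ℕ} {S : Finset ℕ}
    (h : Envies I θ X i S) : Envies I θ' X i S :=
  h.trans_le (mul_le_mul_of_nonneg_right (by linarith) (hI.val_nonneg i S))

theorem Envies.val_le (hI : I.Valid) {θ : ℝ} (hθ : 0 ≤ θ) {i : ℕ} {S : Finset ℕ}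
    (h : Envies I θ X i S) : I.val i (X i) ≤ I.val i S := by
  have := h.of_le hI hθ
  simpa [Envies] using le_of_lt this

theorem mem_pool {g : ℕ} :
    g ∈ I.pool X ↔ g < I.numGoods ∧ ∀ i < I.numAgents, g ∉ X i := by
  simp [Input.pool]

theorem disjoint_pool {i : ℕ} (hi : i < I.numAgents) : Disjoint (X i) (I.pool X) :=
  disjoint_left.2 fun _ hg hp => (mem_pool.1 hp).2 i hi hg

/-- When nobody loses, envy can only decrease, so the new bundles may be compared with the values of
the old ones. -/
theorem Fair.of_replace
    (sub : ∀ i < I.numAgents, X' i ⊆ range I.numGoods)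
    (disj : ∀ i < I.numAgents, ∀ j < I.numAgents, i ≠ j → Disjoint (X' i) (X' j))
    (efx : ∀ j < I.numAgents, ∀ g ∈ X' j, ∀ i < I.numAgents,
      ¬ Envies I I.eps X i ((X' j).erase g))
    (hle : ∀ i < I.numAgents, I.val i (X i) ≤ I.val i (X' i)) : Fair I X' :=
  ⟨sub, disj, fun i hi j hj g hg h => efx j hj g hg i hi ((hle i hi).trans_lt h)⟩

/-- The minimality `hmin` is precisely the EFX condition towards the new bundle of `c`. The old
bundle of `c` returns to the pool, which may grow; the gain of `c` is the progress. -/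
theorem Fair.swap (hI : I.Valid) (hX : Fair I X) {c : ℕ} (hc : c < I.numAgents) {S : Finset ℕ}
    (hS : S ⊆ I.pool X) (hcS : Envies I I.eps X c S)
    (hmin : ∀ h ∈ S, ∀ i < I.numAgents, ¬ Envies I I.eps X i (S.erase h))
    (h1 : X' c = S) (h2 : ∀ i, i ≠ c → X' i = X i) : Fair I X' ∧ Progress I X X' := by
  have hle : ∀ i < I.numAgents, I.val i (X i) ≤ I.val i (X' i) := by
    intro i _
    by_cases h : i = c
    · subst h; rw [h1]; exact hcS.val_le hI hI.eps_pos.le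
    · rw [h2 i h]
  have hdis : ∀ i < I.numAgents, i ≠ c → Disjoint (X' i) (X' c) := by
    intro i hi h
    rw [h2 i h, h1]
    exact (disjoint_pool hi).mono_right hS
  refine ⟨Fair.of_replace ?_ ?_ ?_ hle, hle, Or.inl ⟨c, hc, ?_⟩⟩
  · intro i hi
    by_cases h : i = c
    · subst h; rw [h1]; exact hS.trans sdiff_subset
    · rw [h2 i h]; exact hX.sub i hi
  · intro i hi j hj hij
    by_cases h : i = c
    · subst h; exact (hdis j hj hij.symm).symm
    · by_cases h' : j = c
      · subst h'; exact hdis i hi h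
      · rw [h2 i h, h2 j h']; exact hX.disj i hi j hj hij
  · intro j hj g hg i hi
    by_cases h : j = c
    · subst h; rw [h1] at hg ⊢; exact hmin g hg i hi
    · rw [h2 j h] at hg ⊢; exact hX.efx i hi j hj g hg
  · rw [h1]; exact hcS.of_le hI (by linarith [hI.eps_pos])

theorem Fair.add (hI : I.Valid) (hX : Fair I X) {c : ℕ} (hc : c < I.numAgents) {g : ℕ}
    (hg : g ∈ I.pool X) (hno : ∀ i < I.numAgents, ¬ Envies I I.eps X i (insert g (X c)))
    (h1 : X' c = insert g (X c)) (h2 : ∀ i, i ≠ c → X' i = X i) :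
    Fair I X' ∧ Progress I X X' := by
  have hsub : ∀ i, X i ⊆ X' i := by
    intro i
    by_cases h : i = c
    · subst h; rw [h1]; exact subset_insert _ _
    · rw [h2 i h]
  have hle : ∀ i < I.numAgents, I.val i (X i) ≤ I.val i (X' i) :=
    fun i _ => hI.val_mono i (hsub i)
  have hdis : ∀ i < I.numAgents, i ≠ c → Disjoint (X' i) (X' c) := by
    intro i hi h
    rw [h2 i h, h1, disjoint_insert_right]
    exact ⟨(mem_pool.1 hg).2 i hi, hX.disj i hi c hc h⟩
  refine ⟨Fair.of_replace ?_ ?_ ?_ hle, hle, Or.inr (card_lt_card ?_)⟩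
  · intro i hi
    by_cases h : i = c
    · subst h; rw [h1]
      exact insert_subset (mem_range.2 (mem_pool.1 hg).1) (hX.sub i hi)
    · rw [h2 i h]; exact hX.sub i hi
  · intro i hi j hj hij
    by_cases h : i = c
    · subst h; exact (hdis j hj hij.symm).symm
    · by_cases h' : j = c
      · subst h'; exact hdis i hi h
      · rw [h2 i h, h2 j h']; exact hX.disj i hi j hj hij
  · intro j hj h' hh' i hi
    by_cases h : j = c
    · subst h; rw [h1] at hh' ⊢
      exact fun he => hno i hi (he.mono hI (by linarith [hI.eps_le]) (erase_subset _ _))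
    · rw [h2 j h] at hh' ⊢; exact hX.efx i hi j hj h' hh'
  · refine (ssubset_iff_of_subset ?_).2 ⟨g, hg, ?_⟩
    · intro h hh
      rw [mem_pool] at hh ⊢
      exact ⟨hh.1, fun i hi hm => hh.2 i hi (hsub i hm)⟩
    · intro hh
      exact (mem_pool.1 hh).2 c hc (by rw [h1]; exact mem_insert_self _ _)

theorem iterate_lt {φ : ℕ → ℕ} {n : ℕ} (hφ : ∀ j < n, φ j < n) {x : ℕ} (hx : x < n) (a : ℕ) :
    φ^[a] x < n := by
  induction a with
  | zero => exact hx
  | succ a ih => rw [Function.iterate_succ_apply']; exact hφ _ ih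

/-- `B j` passes from `j` to `φ j` along the cycle through `y`, and agents off the cycle keep their
bundles. Distinct recipients on the cycle get disjoint bundles by `hdis`. The goods in use come from
the pool or from old bundles of cycle agents, all of whom receive something new. -/
theorem Fair.rotate (hI : I.Valid) (hX : Fair I X) {φ : ℕ → ℕ} {B : ℕ → Finset ℕ} {y : ℕ}
    (hφ : ∀ j < I.numAgents, φ j < I.numAgents) (hy : y < I.numAgents)
    (hper : y ∈ Function.periodicPts φ)
    (henvy : ∀ j < I.numAgents, Envies I (I.eps / 2) X (φ j) (B j))
    (hmin : ∀ j < I.numAgents, ∀ h ∈ B j, ∀ i < I.numAgents,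
      ¬ Envies I I.eps X i ((B j).erase h))
    (hsub : ∀ j < I.numAgents, B j ⊆ X j ∪ I.pool X)
    (hdis : ∀ j < I.numAgents, ∀ j' < I.numAgents, φ j ≠ φ j' → Disjoint (B j) (B j'))
    (h1 : ∀ a, X' (φ (φ^[a] y)) = B (φ^[a] y))
    (h2 : ∀ k, (∀ a, k ≠ φ (φ^[a] y)) → X' k = X k) : Fair I X' ∧ Progress I X X' := by
  have hlt : ∀ a, φ^[a] y < I.numAgents := iterate_lt hφ hy
  -- Every agent on the cycle is also a recipient: its predecessor lies `p - 1` steps further along.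
  have hcyc : ∀ a, ∃ b, φ^[a] y = φ (φ^[b] y) := by
    intro a
    obtain ⟨p, hp, hpy⟩ := hper
    refine ⟨a + (p - 1), ?_⟩
    rw [← Function.iterate_succ_apply' φ, show (a + (p - 1)).succ = a + p by omega,
      Function.iterate_add_apply, hpy.eq]
  have hle : ∀ i < I.numAgents, I.val i (X i) ≤ I.val i (X' i) := by
    intro i _
    by_cases h : ∀ a, i ≠ φ (φ^[a] y)
    · rw [h2 i h]
    · push Not at h
      obtain ⟨a, rfl⟩ := h
      rw [h1]
      exact (henvy _ (hlt a)).val_le hI (by linarith [hI.eps_pos])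
  have hmix : ∀ a, ∀ j < I.numAgents, (∀ a, j ≠ φ (φ^[a] y)) →
      Disjoint (X' (φ (φ^[a] y))) (X' j) := by
    intro a j hj h
    rw [h1, h2 j h]
    refine Disjoint.mono_left (hsub _ (hlt a)) ?_
    rw [disjoint_union_left]
    refine ⟨hX.disj _ (hlt a) j hj ?_, (disjoint_pool hj).symm⟩
    intro he
    obtain ⟨b, hb⟩ := hcyc a
    exact h b (he ▸ hb)
  refine ⟨Fair.of_replace ?_ ?_ ?_ hle, hle, Or.inl ⟨φ y, hφ y hy, ?_⟩⟩
  · intro i hi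
    by_cases h : ∀ a, i ≠ φ (φ^[a] y)
    · rw [h2 i h]; exact hX.sub i hi
    · push Not at h
      obtain ⟨a, rfl⟩ := h
      rw [h1]
      exact (hsub _ (hlt a)).trans (union_subset (hX.sub _ (hlt a)) sdiff_subset)
  · intro i hi j hj hij
    by_cases h : ∀ a, i ≠ φ (φ^[a] y)
    · by_cases h' : ∀ a, j ≠ φ (φ^[a] y)
      · rw [h2 i h, h2 j h']; exact hX.disj i hi j hj hij
      · push Not at h'
        obtain ⟨a, rfl⟩ := h'
        exact (hmix a i hi h).symm
    · push Not at h
      obtain ⟨a, rfl⟩ := h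
      by_cases h' : ∀ a, j ≠ φ (φ^[a] y)
      · exact hmix a j hj h'
      · push Not at h'
        obtain ⟨b, rfl⟩ := h'
        rw [h1, h1]
        exact hdis _ (hlt a) _ (hlt b) hij
  · intro j hj g hg i hi
    by_cases h : ∀ a, j ≠ φ (φ^[a] y)
    · rw [h2 j h] at hg ⊢; exact hX.efx i hi j hj g hg
    · push Not at h
      obtain ⟨a, rfl⟩ := h
      rw [h1] at hg ⊢
      exact hmin _ (hlt a) g hg i hi
  · have := h1 0
    simp only [Function.iterate_zero, id] at this
    rw [this]
    exact henvy y hy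

/-- Two of the `n + 1` points `x`, `φ x`, ..., `φ^[n] x` coincide, so the orbit has entered its
cycle after `n` steps. The bound `p ≤ n` ensures that `n` further steps visit the whole cycle. -/
theorem exists_isPeriodicPt_iterate {φ : ℕ → ℕ} {n : ℕ} (hφ : ∀ j < n, φ j < n) {x : ℕ}
    (hx : x < n) : ∃ p, 0 < p ∧ p ≤ n ∧ Function.IsPeriodicPt φ p (φ^[n] x) := by
  have hlt : ∀ a, φ^[a] x < n := iterate_lt hφ hx
  obtain ⟨a, ha, b, hb, hab, he⟩ := exists_ne_map_eq_of_card_lt_of_maps_to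
    (s := range (n + 1)) (t := range n) (f := fun a => φ^[a] x) (by simp)
    (fun a _ => by simpa using hlt a)
  simp only [mem_range] at ha hb
  have key : ∀ a b, a < b → b ≤ n → φ^[a] x = φ^[b] x →
      ∃ p, 0 < p ∧ p ≤ n ∧ Function.IsPeriodicPt φ p (φ^[n] x) := by
    intro a b hab hb he
    refine ⟨b - a, by omega, by omega, ?_⟩
    have h0 : Function.IsPeriodicPt φ (b - a) (φ^[a] x) := by
      unfold Function.IsPeriodicPt Function.IsFixedPt
      rw [← Function.iterate_add_apply, show b - a + a = b by omega, he]
    have := h0.apply_iterate (n - a)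
    rwa [← Function.iterate_add_apply, show n - a + a = n by omega] at this
  rcases lt_or_gt_of_ne hab with h | h
  · exact key a b h (by omega) he
  · exact key b a h (by omega) he.symm

/-! ### The number of rounds -/

/-- A bound for the number of times that the value of a bundle can still grow by the factor
`1 / (1 - ε / 2)`, where `W` bounds the ratio of the largest to the smallest positive value. -/
noncomputable def level (I : Input) (W : ℝ) (i : ℕ) (x : ℝ) : ℝ :=
  if x ≤ 0 then 1 + Real.log W / -Real.log (1 - I.eps / 2)
  else Real.log (I.val i (range I.numGoods) / x) / -Real.log (1 - I.eps / 2)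

/-- The potential that decreases in every round. -/
noncomputable def potential (I : Input) (W : ℝ) (X : ℕ → Finset ℕ) : ℝ :=
  ∑ i ∈ range I.numAgents, (I.numGoods + 1) * level I W i (I.val i (X i)) + (I.pool X).card

/-- Makes the number of multiplicative gains linear in `1 / ε`. -/
theorem Input.Valid.rate (hI : I.Valid) : I.eps / 2 ≤ -Real.log (1 - I.eps / 2) := by
  have := Real.log_le_sub_one_of_pos (x := 1 - I.eps / 2) (by linarith [hI.eps_le])
  linarith

/-- A bundle of positive value contains a good of positive value, to which the hypothesis on `W`
applies. -/
theorem le_mul_val (hI : I.Valid) {W : ℝ} {i : ℕ} (hi : i < I.numAgents) (hW : 1 ≤ W)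
    (hWv : ∀ i < I.numAgents, ∀ g < I.numGoods, 0 < I.value i g →
      I.val i (range I.numGoods) ≤ W * I.value i g)
    {S : Finset ℕ} (hS : S ⊆ range I.numGoods) (h : 0 < I.val i S) :
    I.val i (range I.numGoods) ≤ W * I.val i S := by
  obtain ⟨g, hg, hpos⟩ := exists_lt_of_sum_lt (s := S) (f := fun _ => (0 : ℝ))
    (g := I.value i) (by simpa [Input.val] using h)
  refine (hWv i hi g (mem_range.1 (hS hg)) hpos).trans ?_
  gcongr
  exact single_le_sum (f := I.value i) (fun g _ => hI.value_nonneg i g) hg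

theorem level_nonneg (hI : I.Valid) {W : ℝ} (hW : 1 ≤ W) (i : ℕ) {S : Finset ℕ}
    (hS : S ⊆ range I.numGoods) : 0 ≤ level I W i (I.val i S) := by
  have hr : 0 < -Real.log (1 - I.eps / 2) := by linarith [hI.rate, hI.eps_pos]
  unfold level
  split_ifs with h
  · have := Real.log_nonneg hW
    positivity
  · have h' := not_le.1 h
    refine div_nonneg (Real.log_nonneg ?_) hr.le
    rw [le_div_iff₀ h', one_mul]
    exact hI.val_mono i hS

theorem level_le (hI : I.Valid) {W : ℝ} {i : ℕ} (hi : i < I.numAgents) (hW : 1 ≤ W)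
    (hWv : ∀ i < I.numAgents, ∀ g < I.numGoods, 0 < I.value i g →
      I.val i (range I.numGoods) ≤ W * I.value i g)
    {S : Finset ℕ} (hS : S ⊆ range I.numGoods) (h : 0 < I.val i S) :
    level I W i (I.val i S) ≤ Real.log W / -Real.log (1 - I.eps / 2) := by
  have hr : 0 < -Real.log (1 - I.eps / 2) := by linarith [hI.rate, hI.eps_pos]
  unfold level
  rw [if_neg (not_le.2 h)]
  have h3 : 0 < I.val i (range I.numGoods) := h.trans_le (hI.val_mono i hS)
  gcongr
  rw [div_le_iff₀ h]
  exact le_mul_val hI hi hW hWv hS h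

theorem level_step (hI : I.Valid) {W : ℝ} {i : ℕ} (hi : i < I.numAgents) (hW : 1 ≤ W)
    (hWv : ∀ i < I.numAgents, ∀ g < I.numGoods, 0 < I.value i g →
      I.val i (range I.numGoods) ≤ W * I.value i g)
    {S : Finset ℕ} (hS : S ⊆ range I.numGoods) {x : ℝ} (hx : 0 ≤ x)
    (h : x < (1 - I.eps / 2) * I.val i S) :
    level I W i (I.val i S) + 1 ≤ level I W i x := by
  have hr : 0 < -Real.log (1 - I.eps / 2) := by linarith [hI.rate, hI.eps_pos]
  have he : 0 < 1 - I.eps / 2 := by linarith [hI.eps_le]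
  have hpos : 0 < I.val i S := pos_of_mul_pos_right (hx.trans_lt h) he.le
  rcases hx.eq_or_lt with rfl | hx
  -- The jump away from value zero is not multiplicative; the summand 1 in `level` pays for it.
  · have := level_le hI hi hW hWv hS hpos
    have h2 : level I W i 0 = 1 + Real.log W / -Real.log (1 - I.eps / 2) := by simp [level]
    rw [h2]; linarith
  · have h3 : 0 < I.val i (range I.numGoods) := hpos.trans_le (hI.val_mono i hS)
    unfold level
    rw [if_neg (not_le.2 hpos), if_neg (not_le.2 hx), ← le_sub_iff_add_le, ← sub_nonneg]
    have h4 := Real.log_lt_log hx h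
    rw [Real.log_mul he.ne' hpos.ne'] at h4
    rw [Real.log_div h3.ne' hpos.ne', Real.log_div h3.ne' hx.ne']
    have : (Real.log (I.val i (range I.numGoods)) - Real.log x) / -Real.log (1 - I.eps / 2) - 1 -
        (Real.log (I.val i (range I.numGoods)) - Real.log (I.val i S)) /
          -Real.log (1 - I.eps / 2) =
        (Real.log (1 - I.eps / 2) + Real.log (I.val i S) - Real.log x) /
          -Real.log (1 - I.eps / 2) := by
      have hne : Real.log (1 - I.eps / 2) ≠ 0 := by linarith
      generalize Real.log (1 - I.eps / 2) = L at hne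
      field_simp
      ring
    rw [this]
    exact div_nonneg (by linarith) hr.le

theorem level_anti (hI : I.Valid) {W : ℝ} {i : ℕ} (hi : i < I.numAgents) (hW : 1 ≤ W)
    (hWv : ∀ i < I.numAgents, ∀ g < I.numGoods, 0 < I.value i g →
      I.val i (range I.numGoods) ≤ W * I.value i g)
    {S : Finset ℕ} (hS : S ⊆ range I.numGoods) {x : ℝ} (hx : 0 ≤ x) (h : x ≤ I.val i S) :
    level I W i (I.val i S) ≤ level I W i x := by
  have hr : 0 < -Real.log (1 - I.eps / 2) := by linarith [hI.rate, hI.eps_pos]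
  rcases hx.eq_or_lt with rfl | hx
  · have h2 : level I W i 0 = 1 + Real.log W / -Real.log (1 - I.eps / 2) := by simp [level]
    rcases h.eq_or_lt with h | h
    · rw [← h]
    · have := level_le hI hi hW hWv hS h
      linarith
  · have hpos := hx.trans_le h
    have h3 : 0 < I.val i (range I.numGoods) := hpos.trans_le (hI.val_mono i hS)
    unfold level
    rw [if_neg (not_le.2 hpos), if_neg (not_le.2 hx)]
    gcongr

theorem potential_nonneg (hI : I.Valid) {W : ℝ} (hW : 1 ≤ W) (hX : Fair I X) :
    0 ≤ potential I W X := by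
  unfold potential
  have : 0 ≤ ∑ i ∈ range I.numAgents, ((I.numGoods : ℝ) + 1) * level I W i (I.val i (X i)) :=
    sum_nonneg fun i hi => mul_nonneg (by positivity)
      (level_nonneg hI hW i (hX.sub i (mem_range.1 hi)))
  positivity

theorem Progress.potential_add_one_le (hI : I.Valid) {W : ℝ} (hW : 1 ≤ W)
    (hWv : ∀ i < I.numAgents, ∀ g < I.numGoods, 0 < I.value i g →
      I.val i (range I.numGoods) ≤ W * I.value i g)
    (hX' : Fair I X') (h : Progress I X X') :
    potential I W X' + 1 ≤ potential I W X := by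
  have hmono : ∀ i ∈ range I.numAgents,
      ((I.numGoods : ℝ) + 1) * level I W i (I.val i (X' i)) ≤
        (I.numGoods + 1) * level I W i (I.val i (X i)) := by
    intro i hi
    rw [mem_range] at hi
    have := level_anti hI hi hW hWv (hX'.sub i hi) (hI.val_nonneg i (X i)) (h.1 i hi)
    gcongr
  unfold potential
  rcases h.2 with ⟨i, hi, he⟩ | hlt
  -- A gain may enlarge the pool by up to `m` goods; the weight `m + 1` of a level outweighs this by
  -- one.
  · have hp : ((I.pool X').card : ℝ) ≤ I.numGoods := by
      exact_mod_cast (card_le_card sdiff_subset).trans (card_range _).le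
    have hi' : i ∈ range I.numAgents := mem_range.2 hi
    rw [← add_sum_erase _ _ hi', ← add_sum_erase _ _ hi']
    have h1 := sum_le_sum fun j (hj : j ∈ (range I.numAgents).erase i) =>
      hmono j (mem_of_mem_erase hj)
    have h2 := level_step hI hi hW hWv (hX'.sub i hi) (hI.val_nonneg i (X i)) he
    have h3 : ((I.numGoods : ℝ) + 1) * (level I W i (I.val i (X' i)) + 1) ≤
        (I.numGoods + 1) * level I W i (I.val i (X i)) := by gcongr
    have h4 : (0 : ℝ) ≤ (I.pool X).card := by positivity
    linarith
  · have h1 := sum_le_sum hmono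
    have h2 : ((I.pool X').card : ℝ) + 1 ≤ (I.pool X).card := by exact_mod_cast hlt
    linarith

theorem potential_empty_le (hI : I.Valid) {W : ℝ} (hW : 1 ≤ W) :
    potential I W (fun _ => ∅) ≤
      I.numAgents * ((I.numGoods + 1) * (1 + 2 * Real.logb 2 W * (1 / I.eps))) + I.numGoods := by
  have hr := hI.rate
  have he := hI.eps_pos
  have hlog := Real.log_nonneg hW
  have h2 : Real.log 2 ≤ 1 := by linarith [Real.log_two_lt_d9]
  have h3 : Real.log W ≤ Real.logb 2 W := by
    rw [Real.logb, le_div_iff₀ (Real.log_pos one_lt_two)]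
    nlinarith
  have h4 : Real.log W / -Real.log (1 - I.eps / 2) ≤ 2 * Real.logb 2 W * (1 / I.eps) := by
    calc Real.log W / -Real.log (1 - I.eps / 2) ≤ Real.logb 2 W / (I.eps / 2) := by
          gcongr
          exact hlog.trans h3
      _ = _ := by field_simp
  have hp : ((I.pool fun _ => ∅).card : ℝ) ≤ I.numGoods := by
    exact_mod_cast (card_le_card sdiff_subset).trans (card_range _).le
  unfold potential
  refine add_le_add ?_ hp
  have : ∀ i, level I W i (I.val i ∅) = 1 + Real.log W / -Real.log (1 - I.eps / 2) := by
    intro i; simp [level, Input.val]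
  simp only [this, sum_const, card_range, nsmul_eq_mul]
  gcongr

/-! ### The size of the pool -/

/-- The agents to whom good `g` is worth a substantial part of their own bundle. -/
noncomputable def valuers (I : Input) (X : ℕ → Finset ℕ) (g : ℕ) : Finset ℕ :=
  (range I.numAgents).filter fun i => I.eps * I.val i (X i) < 2 * I.value i g

/-- The bundle of `s` is not even (ε/2)-envied, whereas with `g` it is ε-envied. The gap between the
two thresholds must be filled by the value of `g` alone. -/
theorem mem_valuers (hI : I.Valid) {s g i : ℕ} (hi : i < I.numAgents)
    (hs : ¬ Envies I (I.eps / 2) X i (X s)) {S : Finset ℕ} (hS : S ⊆ insert g (X s))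
    (h : Envies I I.eps X i S) : i ∈ valuers I X g := by
  refine mem_filter.2 ⟨mem_range.2 hi, ?_⟩
  by_contra hv
  have he := hI.eps_pos
  have he' := hI.eps_le
  have h1 : Envies I I.eps X i (insert g (X s)) := h.mono hI (by linarith) hS
  have h2 : I.val i (insert g (X s)) ≤ I.value i g + I.val i (X s) := by
    unfold Input.val
    by_cases hg : g ∈ X s
    · rw [insert_eq_of_mem hg]; linarith [hI.value_nonneg i g]
    · rw [sum_insert hg]
  unfold Envies at h1 hs
  have h0 := hI.val_nonneg i (X i)
  have h3 : I.val i (X i) < (1 - I.eps) * (I.value i g + I.val i (X s)) :=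
    h1.trans_le (by gcongr; linarith)
  push Not at hv hs
  have h4 : (1 - I.eps / 2) * I.val i (X i) <
      (1 - I.eps) * ((1 - I.eps / 2) * I.value i g + (1 - I.eps / 2) * I.val i (X s)) := by
    nlinarith
  have h5 : (1 - I.eps) * ((1 - I.eps / 2) * I.value i g + (1 - I.eps / 2) * I.val i (X s)) ≤
      (1 - I.eps) * ((1 - I.eps / 2) * (I.eps / 2 * I.val i (X i)) + I.val i (X i)) := by
    gcongr
    · linarith
    · linarith
    · linarith
  -- With x the value of the own bundle, `h4` and `h5` contradict each other with slack x (ε²/2 +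
  -- ε²(1-ε)/4), a combination of `h6` and `h7`.
  have h6 : 0 ≤ I.val i (X i) * (I.eps * I.eps) := by positivity
  have h7 : 0 ≤ I.val i (X i) * (I.eps * I.eps) * (1 - I.eps) := mul_nonneg h6 (by linarith)
  nlinarith

/-- Removing the agents with the most popular champion. -/
theorem card_filter_ne_le {U T : Finset ℕ} {K : ℕ → ℕ} {t : ℕ} (hK : ∀ s ∈ U, K s ∈ T)
    (ht : ∀ t' ∈ T, (U.filter fun s => K s = t').card ≤ (U.filter fun s => K s = t).card) :
    ((U.filter fun s => K s ≠ t).card : ℝ) ≤ U.card * Real.exp (-(1 / T.card)) := by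
  rcases U.eq_empty_or_nonempty with rfl | ⟨s, hs⟩
  · simp
  have hT : 0 < T.card := card_pos.2 ⟨_, hK s hs⟩
  have h1 : U.card ≤ (U.filter fun s => K s = t).card * T.card :=
    card_le_mul_card_image_of_maps_to hK _ ht
  have h2 := card_filter_add_card_filter_not (s := U) (fun s => K s = t)
  have h3 : (0 : ℝ) < T.card := by exact_mod_cast hT
  have h4 : (U.card : ℝ) / T.card ≤ (U.filter fun s => K s = t).card := by
    rw [div_le_iff₀ h3]; exact_mod_cast h1
  have h5 : ((U.filter fun s => K s = t).card : ℝ) + (U.filter fun s => K s ≠ t).card = U.card := by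
    exact_mod_cast h2
  have h6 := Real.add_one_le_exp (-(1 / (T.card : ℝ)))
  calc ((U.filter fun s => K s ≠ t).card : ℝ) ≤ U.card * (-(1 / T.card) + 1) := by
        have : (U.card : ℝ) * (-(1 / T.card) + 1) = U.card - U.card / T.card := by ring
        rw [this]; linarith
    _ ≤ _ := by gcongr

/-- Double counting: as ε ≤ 1/2, an agent that does not envy the pool values it at most twice its
own bundle. So at most 4/ε pool goods are worth more than ε/2 of that bundle. -/
theorem sum_card_valuers_le (hI : I.Valid)
    (hp : ∀ i < I.numAgents, ¬ Envies I I.eps X i (I.pool X)) :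
    ∑ g ∈ I.pool X, ((valuers I X g).card : ℝ) ≤ 4 * (I.numAgents / I.eps) := by
  have he := hI.eps_pos
  have he' := hI.eps_le
  have hswap : ∑ g ∈ I.pool X, (valuers I X g).card = ∑ i ∈ range I.numAgents,
      ((I.pool X).filter fun g => I.eps * I.val i (X i) < 2 * I.value i g).card :=
    sum_card_bipartiteAbove_eq_sum_card_bipartiteBelow
      (fun g i => I.eps * I.val i (X i) < 2 * I.value i g)
  have hone : ∀ i ∈ range I.numAgents,
      (((I.pool X).filter fun g => I.eps * I.val i (X i) < 2 * I.value i g).card : ℝ) ≤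
        4 / I.eps := by
    intro i hi
    set F := (I.pool X).filter fun g => I.eps * I.val i (X i) < 2 * I.value i g with hF
    rw [mem_range] at hi
    have h1 := hp i hi
    unfold Envies at h1
    push Not at h1
    have h2 : I.val i (I.pool X) ≤ 2 * I.val i (X i) := by
      nlinarith [hI.val_nonneg i (I.pool X)]
    rcases F.eq_empty_or_nonempty with h | h
    · rw [h]; simp; positivity
    have h3 : (F.card : ℝ) * (I.eps * I.val i (X i)) < 2 * I.val i (I.pool X) := by
      calc (F.card : ℝ) * (I.eps * I.val i (X i)) = ∑ g ∈ F, I.eps * I.val i (X i) := by simp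
        _ < ∑ g ∈ F, 2 * I.value i g := sum_lt_sum_of_nonempty h fun g hg => (mem_filter.1 hg).2
        _ = 2 * I.val i F := by rw [Input.val, mul_sum]
        _ ≤ _ := by have := hI.val_mono i (filter_subset _ _ : F ⊆ I.pool X); linarith
    -- Strictness allows the value of the own bundle to be cancelled without assuming it positive.
    have h4 : (F.card : ℝ) * I.eps * I.val i (X i) < 4 * I.val i (X i) := by linarith
    rw [le_div_iff₀ he]
    exact (lt_of_mul_lt_mul_right h4 (hI.val_nonneg i (X i))).le
  have := sum_le_sum hone
  rw [sum_const, card_range, nsmul_eq_mul] at this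
  calc ∑ g ∈ I.pool X, ((valuers I X g).card : ℝ)
      = ((∑ g ∈ I.pool X, (valuers I X g).card : ℕ) : ℝ) := by push_cast; rfl
    _ ≤ I.numAgents * (4 / I.eps) := by rw [hswap]; push_cast; exact this
    _ = _ := by ring

/-- Cauchy–Schwarz gives |P|² ≤ (Σ D)(Σ 1/D), and the logarithm of `h` bounds the second factor. -/
theorem card_sq_le_mul_log {P : Finset ℕ} {D : ℕ → ℕ} {n : ℕ} (hn : 0 < n) {A : ℝ}
    (hD : ∀ g ∈ P, 1 ≤ D g) (hA : ∑ g ∈ P, (D g : ℝ) ≤ A)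
    (h : 1 ≤ n * Real.exp (-∑ g ∈ P, 1 / (D g : ℝ))) :
    (P.card : ℝ) ^ 2 ≤ A * Real.log n := by
  have hn' : (0 : ℝ) < n := by exact_mod_cast hn
  have h1 : ∑ g ∈ P, 1 / (D g : ℝ) ≤ Real.log n := by
    have := Real.log_nonneg h
    rw [Real.log_mul hn'.ne' (Real.exp_pos _).ne', Real.log_exp] at this
    linarith
  have h2 : (P.card : ℝ) ^ 2 ≤ (∑ g ∈ P, (D g : ℝ)) * ∑ g ∈ P, 1 / (D g : ℝ) := by
    have := sum_sq_le_sum_mul_sum_of_sq_le_mul P (r := fun _ => (1 : ℝ))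
      (f := fun g => (D g : ℝ)) (g := fun g => 1 / (D g : ℝ))
      (fun g _ => by positivity) (fun g _ => by positivity) (fun g hg => by
        have := hD g hg
        have : (D g : ℝ) ≠ 0 := by positivity
        field_simp
        norm_num)
    simpa using this
  have h3 : 0 ≤ ∑ g ∈ P, 1 / (D g : ℝ) := sum_nonneg fun g _ => by positivity
  have h4 : 0 ≤ ∑ g ∈ P, (D g : ℝ) := sum_nonneg fun g _ => by positivity
  calc (P.card : ℝ) ^ 2 ≤ _ := h2
    _ ≤ _ := mul_le_mul hA h1 h3 (h4.trans hA)

theorem card_pool_le (hI : I.Valid) (hp : ∀ i < I.numAgents, ¬ Envies I I.eps X i (I.pool X))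
    (hD : ∀ g ∈ I.pool X, 1 ≤ (valuers I X g).card)
    (h : 1 ≤ I.numAgents * Real.exp (-∑ g ∈ I.pool X, 1 / ((valuers I X g).card : ℝ))) :
    ((I.pool X).card : ℝ) ≤ 64 * ((I.numAgents : ℝ) / I.eps) ^ ((4 : ℝ) / 5) := by
  have he := hI.eps_pos
  have hn : (1 : ℝ) ≤ I.numAgents := by exact_mod_cast hI.agents_pos
  set N : ℝ := I.numAgents / I.eps with hN
  have hnN : (I.numAgents : ℝ) ≤ N := by
    rw [hN, le_div_iff₀ he]; nlinarith [hI.eps_le]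
  have hN0 : 0 < N := by linarith
  have h1 := card_sq_le_mul_log hI.agents_pos hD (sum_card_valuers_le hI hp) h
  -- The exponent 3/5 is the one for which `N * N ^ (3 / 5)` is the square of `N ^ (4 / 5)`. The
  -- resulting constant 20/3 is far below 64².
  have h2 : Real.log I.numAgents ≤ N ^ ((3 : ℝ) / 5) / (3 / 5) :=
    (Real.log_le_log (by linarith) hnN).trans (Real.log_le_rpow_div hN0.le (by norm_num))
  have h3 : N * N ^ ((3 : ℝ) / 5) = (N ^ ((4 : ℝ) / 5)) ^ 2 := by
    rw [← Real.rpow_natCast, ← Real.rpow_mul hN0.le]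
    nth_rewrite 1 [← Real.rpow_one N]
    rw [← Real.rpow_add hN0]
    norm_num
  refine abs_le_of_sq_le_sq' ?_ (by positivity) |>.2
  calc ((I.pool X).card : ℝ) ^ 2 ≤ 4 * N * Real.log I.numAgents := h1
    _ ≤ 4 * N * (N ^ ((3 : ℝ) / 5) / (3 / 5)) := by gcongr
    _ = 20 / 3 * (N ^ ((4 : ℝ) / 5)) ^ 2 := by rw [← h3]; ring
    _ ≤ _ := by rw [mul_pow]; nlinarith [sq_nonneg (N ^ ((4 : ℝ) / 5))]

/-! ### Greedy choice of champions -/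

/-- The state of the greedy choice after the goods below `k` have been treated: `U` is the set of
agents whose bundle has no taker yet; the bundle of every other agent `j` is to be replaced by
`B j`, which goes to agent `φ j`. -/
structure Greedy (I : Input) (X : ℕ → Finset ℕ) (k : ℕ) (U : Finset ℕ) (φ : ℕ → ℕ)
    (B : ℕ → Finset ℕ) : Prop where
  sub : U ⊆ range I.numAgents
  unenvied : ∀ j ∈ U, ∀ i < I.numAgents, ¬ Envies I (I.eps / 2) X i (X j)
  lt : ∀ j < I.numAgents, j ∉ U → φ j < I.numAgents
  envies : ∀ j < I.numAgents, j ∉ U → Envies I (I.eps / 2) X (φ j) (B j)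
  minimal : ∀ j < I.numAgents, j ∉ U → ∀ h ∈ B j, ∀ i < I.numAgents,
    ¬ Envies I I.eps X i ((B j).erase h)
  bundle : ∀ j < I.numAgents, j ∉ U → B j ⊆ X j ∪ (I.pool X).filter (· < k)
  disj : ∀ j < I.numAgents, j ∉ U → ∀ j' < I.numAgents, j' ∉ U → φ j ≠ φ j' →
    Disjoint (B j) (B j')
  card_le : (U.card : ℝ) ≤ I.numAgents *
    Real.exp (-∑ g ∈ (I.pool X).filter (· < k), 1 / ((valuers I X g).card : ℝ))
  one_le : U.Nonempty → ∀ g ∈ (I.pool X).filter (· < k), 1 ≤ (valuers I X g).card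

variable {U U' : Finset ℕ} {φ φ' : ℕ → ℕ} {B B' : ℕ → Finset ℕ} {k : ℕ}

/-- An (ε/2)-envied bundle is passed on unchanged, and its minimality is the EFX property of `X`. -/
theorem Greedy.init (hX : Fair I X) (sub : U ⊆ range I.numAgents)
    (unenvied : ∀ j ∈ U, ∀ i < I.numAgents, ¬ Envies I (I.eps / 2) X i (X j))
    (lt : ∀ j < I.numAgents, j ∉ U → φ j < I.numAgents)
    (envies : ∀ j < I.numAgents, j ∉ U → Envies I (I.eps / 2) X (φ j) (X j))
    (hB : ∀ j < I.numAgents, B j = X j) : Greedy I X 0 U φ B where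
  sub := sub
  unenvied := unenvied
  lt := lt
  envies := fun j hj hU => by rw [hB j hj]; exact envies j hj hU
  minimal := fun j hj _ h hh i hi => by rw [hB j hj] at hh ⊢; exact hX.efx i hi j hj h hh
  bundle := fun j hj _ => by rw [hB j hj]; exact subset_union_left
  disj := fun j hj _ j' hj' _ hne => by
    rw [hB j hj, hB j' hj']
    exact hX.disj j hj j' hj' fun h => hne (by rw [h])
  card_le := by
    have := card_le_card sub
    rw [card_range] at this
    simpa using this
  one_le := by simp

theorem filter_lt_succ_of_notMem {P : Finset ℕ} (hk : k ∉ P) :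
    P.filter (· < k + 1) = P.filter (· < k) := by
  ext g
  simp only [mem_filter, and_congr_right_iff]
  intro hg
  have : g ≠ k := fun h => hk (h ▸ hg)
  omega

theorem filter_lt_succ_of_mem {P : Finset ℕ} (hk : k ∈ P) :
    P.filter (· < k + 1) = insert k (P.filter (· < k)) := by
  ext g
  simp only [mem_filter, mem_insert]
  constructor
  · rintro ⟨h1, h2⟩
    by_cases h : g = k
    · exact Or.inl h
    · exact Or.inr ⟨h1, by omega⟩
  · rintro (rfl | ⟨h1, h2⟩)
    · exact ⟨hk, by omega⟩
    · exact ⟨h1, by omega⟩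

theorem Greedy.skip (h : Greedy I X k U φ B) (hk : k ∉ I.pool X) : Greedy I X (k + 1) U φ B := by
  have he := filter_lt_succ_of_notMem hk
  exact ⟨h.sub, h.unenvied, h.lt, h.envies, h.minimal, by simpa only [he] using h.bundle,
    h.disj, by simpa only [he] using h.card_le, by simpa only [he] using h.one_le⟩

/-- Here `K j` is the champion of the bundle of `j` with `k`, and `D j` its minimal envied subset.
All bundles that receive `k` go to `t`, so disjointness survives for different takers, although not
for equal ones. Since all champions are valuers of `k`, the most popular one serves at least the
fraction 1/d_k of `U`. -/
theorem Greedy.step (hI : I.Valid) (hX : Fair I X) (h : Greedy I X k U φ B) (hk : k ∈ I.pool X)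
    {K : ℕ → ℕ} {D : ℕ → Finset ℕ} {t : ℕ}
    (hK : ∀ j ∈ U, K j < I.numAgents) (hKe : ∀ j ∈ U, Envies I I.eps X (K j) (D j))
    (hD : ∀ j ∈ U, D j ⊆ insert k (X j))
    (hDm : ∀ j ∈ U, ∀ h ∈ D j, ∀ i < I.numAgents, ¬ Envies I I.eps X i ((D j).erase h))
    (ht : ∀ t' < I.numAgents,
      (U.filter fun s => K s = t').card ≤ (U.filter fun s => K s = t).card)
    (hU' : U' = U.filter fun j => K j ≠ t)
    (hφ' : ∀ j < I.numAgents, φ' j = if j ∈ U ∧ K j = t then t else φ j)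
    (hB' : ∀ j < I.numAgents, B' j = if j ∈ U ∧ K j = t then D j else B j) :
    Greedy I X (k + 1) U' φ' B' := by
  have he := filter_lt_succ_of_mem hk
  have hv : ∀ j ∈ U, K j ∈ valuers I X k := fun j hj =>
    mem_valuers hI (hK j hj) (h.unenvied j hj _ (hK j hj)) (hD j hj) (hKe j hj)
  have hcases : ∀ j < I.numAgents, j ∉ U' →
      (j ∈ U ∧ φ' j = t ∧ K j = t ∧ B' j = D j) ∨ (j ∉ U ∧ φ' j = φ j ∧ B' j = B j) := by
    intro j hj hjU
    rw [hU', mem_filter, not_and, not_not] at hjU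
    by_cases hjU' : j ∈ U
    · exact Or.inl ⟨hjU', by rw [hφ' j hj, if_pos ⟨hjU', hjU hjU'⟩], hjU hjU', by
        rw [hB' j hj, if_pos ⟨hjU', hjU hjU'⟩]⟩
    · exact Or.inr ⟨hjU', by rw [hφ' j hj, if_neg fun h => hjU' h.1], by
        rw [hB' j hj, if_neg fun h => hjU' h.1]⟩
  -- Bundles fixed earlier contain only pool goods below `k`, and the original bundles are disjoint.
  have hmix : ∀ j ∈ U, ∀ j' < I.numAgents, j' ∉ U → Disjoint (D j) (B j') := by
    intro j hj j' hj' hjU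
    have hjn := mem_range.1 (h.sub hj)
    refine Disjoint.mono (hD j hj) (h.bundle j' hj' hjU) ?_
    rw [disjoint_insert_left, disjoint_union_right, mem_union, mem_filter]
    refine ⟨?_, hX.disj j hjn j' hj' fun he => hjU (he ▸ hj),
      (disjoint_pool hjn).mono_right (filter_subset _ _)⟩
    rintro (h' | h')
    · exact (mem_pool.1 hk).2 j' hj' h'
    · omega
  refine ⟨?_, ?_, ?_, ?_, ?_, ?_, ?_, ?_, ?_⟩
  · rw [hU']; exact (filter_subset _ _).trans h.sub
  · intro j hj
    rw [hU'] at hj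
    exact h.unenvied j (mem_of_mem_filter j hj)
  · intro j hj hjU
    rcases hcases j hj hjU with ⟨h1, h2, h3, h4⟩ | ⟨h1, h2, h3⟩
    · rw [h2, ← h3]; exact hK j h1
    · rw [h2]; exact h.lt j hj h1
  · intro j hj hjU
    rcases hcases j hj hjU with ⟨h1, h2, h3, h4⟩ | ⟨h1, h2, h3⟩
    · rw [h2, h4, ← h3]; exact (hKe j h1).of_le hI (by linarith [hI.eps_pos])
    · rw [h2, h3]; exact h.envies j hj h1
  · intro j hj hjU
    rcases hcases j hj hjU with ⟨h1, h2, h3, h4⟩ | ⟨h1, h2, h3⟩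
    · rw [h4]; exact hDm j h1
    · rw [h3]; exact h.minimal j hj h1
  · intro j hj hjU
    rw [he]
    rcases hcases j hj hjU with ⟨h1, h2, h3, h4⟩ | ⟨h1, h2, h3⟩
    · rw [h4]
      refine (hD j h1).trans (insert_subset ?_ subset_union_left)
      exact mem_union_right _ (mem_insert_self _ _)
    · rw [h3]
      exact (h.bundle j hj h1).trans (union_subset_union_right (subset_insert _ _))
  · intro j hj hjU j' hj' hjU' hne
    rcases hcases j hj hjU with ⟨h1, h2, h3, h4⟩ | ⟨h1, h2, h3⟩ <;>
      rcases hcases j' hj' hjU' with ⟨h1', h2', h3', h4'⟩ | ⟨h1', h2', h3'⟩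
    · exact absurd (h2.trans h2'.symm) hne
    · rw [h4, h3']; exact hmix j h1 j' hj' h1'
    · rw [h3, h4']; exact (hmix j' h1' j hj h1).symm
    · rw [h3, h3']
      exact h.disj j hj h1 j' hj' h1' (by rwa [← h2, ← h2'])
  · rw [he, sum_insert (by simp), neg_add, Real.exp_add]
    have h1 := card_filter_ne_le (T := valuers I X k) hv
      fun t' ht' => ht t' (mem_range.1 (mem_of_mem_filter _ ht'))
    rw [hU']
    calc ((U.filter fun j => K j ≠ t).card : ℝ)
        ≤ U.card * Real.exp (-(1 / (valuers I X k).card)) := h1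
      _ ≤ (I.numAgents * Real.exp (-∑ g ∈ (I.pool X).filter (· < k),
            1 / ((valuers I X g).card : ℝ))) * Real.exp (-(1 / (valuers I X k).card)) := by
          gcongr; exact h.card_le
      _ = _ := by ring
  · rintro ⟨j, hj⟩ g hg
    rw [hU'] at hj
    have hj' := mem_of_mem_filter j hj
    rw [he, mem_insert] at hg
    rcases hg with rfl | hg
    · exact card_pos.2 ⟨_, hv j hj'⟩
    · exact h.one_le ⟨j, hj'⟩ g hg

theorem filter_pool_lt : (I.pool X).filter (· < I.numGoods) = I.pool X :=
  filter_true_of_mem fun _ hg => (mem_pool.1 hg).1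

/-- A remaining agent gives both hypotheses on the valuers: 1 ≤ |U| ≤ n exp(-Σ 1/d_g), and each pool
good had a champion for its bundle, so d_g ≥ 1. -/
theorem Greedy.card_pool_le (hI : I.Valid)
    (hp : ∀ i < I.numAgents, ¬ Envies I I.eps X i (I.pool X))
    (h : Greedy I X I.numGoods U φ B) (hU : U.Nonempty) :
    ((I.pool X).card : ℝ) ≤ 64 * ((I.numAgents : ℝ) / I.eps) ^ ((4 : ℝ) / 5) := by
  have h1 := h.one_le hU
  have h2 := h.card_le
  rw [filter_pool_lt] at h1 h2
  refine EFX.card_pool_le hI hp h1 (le_trans ?_ h2)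
  exact_mod_cast card_pos.2 hU

theorem Greedy.rotate (hI : I.Valid) (hX : Fair I X) (h : Greedy I X I.numGoods ∅ φ B) {y : ℕ}
    (hy : y < I.numAgents) (hper : y ∈ Function.periodicPts φ)
    (h1 : ∀ a, X' (φ (φ^[a] y)) = B (φ^[a] y))
    (h2 : ∀ k, (∀ a, k ≠ φ (φ^[a] y)) → X' k = X k) : Fair I X' ∧ Progress I X X' :=
  hX.rotate hI (fun j hj => h.lt j hj (notMem_empty j)) hy hper
    (fun j hj => h.envies j hj (notMem_empty j)) (fun j hj => h.minimal j hj (notMem_empty j))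
    (fun j hj => by simpa only [filter_pool_lt] using h.bundle j hj (notMem_empty j))
    (fun j hj j' hj' => h.disj j hj (notMem_empty j) j' hj' (notMem_empty j')) h1 h2

/-! ### The allocation algorithm

The arrays of natural numbers are used as follows.

* `0`: the allocation; `1`: the pool; `2`: whether the algorithm is finished
* `3`: the set under consideration; `4`: one more than an agent that envies this set, or `0`
* `5`: one more than the champion of a reduced set, or `0`
* `6`, `7`: champion and reduced set for the pool
* `8`, `9`, `10`: whether some good can be added to some bundle; the agent and the good
* `11`, `12`, `13`: the maps `φ` and `B` and the set `U` of the greedy choice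
* `14`, `15`: champions and reduced sets for one good; `16`, `17`: their popularity
* `18`: the current agent of a rotation; `19`: whether `U` is nonempty
* from `20` on: counters -/

namespace SProg

infixr:60 " ;; " => SProg.seq

/-- The cell `(0, 0)` of an array. -/
abbrev cell (a : ℕ) : NExp := .read a (.lit 0) (.lit 0)

/-- The cell `(0, 0)` of an array of real numbers. -/
abbrev rcell (a : ℕ) : RExp := .read a (.lit 0) (.lit 0)

/-- The test whether a number is positive. -/
abbrev pos (e : NExp) : Test := .ltNat (.lit 0) e

/-- Copy row `si` of array `src` into row `di` of array `dst`. -/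
def copyRow (dst : ℕ) (di : NExp) (src : ℕ) (si : NExp) : SProg :=
  count 20 .goods (setNat dst di (cell 20) (.read src si (cell 20)))

/-- Add up the values of the current set and of the own bundle for the agent in cell `21`. -/
def sumValues : SProg :=
  count 22 .goods
    (ite (pos (.read 3 (.lit 0) (cell 22)))
        (setReal 0 (.lit 0) (.lit 0) (.add (rcell 0) (.value (cell 21) (cell 22)))) skip ;;
      ite (pos (.read 0 (cell 21) (cell 22)))
        (setReal 1 (.lit 0) (.lit 0) (.add (rcell 1) (.value (cell 21) (cell 22)))) skip)

/-- The test for envy with parameter `ε`. -/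
def envyTest : Test := .ltReal (rcell 1) (.sub (rcell 0) (.scale (rcell 0)))

/-- The test for envy with parameter `ε / 2`. -/
def envyTestHalf : Test :=
  .ltReal (.add (rcell 1) (rcell 1)) (.sub (.add (rcell 0) (rcell 0)) (.scale (rcell 0)))

/-- Look for an agent that envies the current set. -/
def findEnvier (b : Test) : SProg :=
  setNat 4 (.lit 0) (.lit 0) (.lit 0) ;;
  count 21 .agents
    (setReal 0 (.lit 0) (.lit 0) (.lit 0) ;; setReal 1 (.lit 0) (.lit 0) (.lit 0) ;;
      sumValues ;; ite b (setNat 4 (.lit 0) (.lit 0) (.add (cell 21) (.lit 1))) skip)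

/-- Remove goods from the current set as long as somebody envies it. -/
def reduce : SProg :=
  findEnvier envyTest ;; setNat 5 (.lit 0) (.lit 0) (cell 4) ;;
  count 23 .goods
    (ite (pos (.read 3 (.lit 0) (cell 23)))
      (setNat 3 (.lit 0) (cell 23) (.lit 0) ;; findEnvier envyTest ;;
        ite (pos (cell 4)) (setNat 5 (.lit 0) (.lit 0) (cell 4))
          (setNat 3 (.lit 0) (cell 23) (.lit 1))) skip)

/-- Compute the pool. -/
def computePool : SProg :=
  count 24 .goods
    (setNat 1 (.lit 0) (cell 24) (.lit 1) ;;
      count 25 .agents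
        (ite (pos (.read 0 (cell 25) (cell 24))) (setNat 1 (.lit 0) (cell 24) (.lit 0)) skip))

/-- Reduce the pool. -/
def reducePool : SProg :=
  copyRow 3 (.lit 0) 1 (.lit 0) ;; reduce ;; setNat 6 (.lit 0) (.lit 0) (cell 5) ;;
  copyRow 7 (.lit 0) 3 (.lit 0)

/-- Make the bundle of the agent in cell `25` with the good in cell `24` the current set. -/
def extendBundle : SProg :=
  copyRow 3 (.lit 0) 0 (cell 25) ;; setNat 3 (.lit 0) (cell 24) (.lit 1)

/-- Look for a good of the pool that can be added to a bundle. -/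
def findAddable : SProg :=
  setNat 8 (.lit 0) (.lit 0) (.lit 0) ;;
  count 24 .goods
    (ite (pos (.read 1 (.lit 0) (cell 24)))
      (count 25 .agents
        (extendBundle ;; findEnvier envyTest ;;
          ite (pos (cell 4)) skip
            (setNat 8 (.lit 0) (.lit 0) (.lit 1) ;; setNat 9 (.lit 0) (.lit 0) (cell 25) ;;
              setNat 10 (.lit 0) (.lit 0) (cell 24)))) skip)

/-- Start of the greedy choice: every envied bundle goes to an agent that envies it. -/
def initGreedy : SProg :=
  count 25 .agents
    (copyRow 3 (.lit 0) 0 (cell 25) ;; copyRow 12 (cell 25) 0 (cell 25) ;;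
      findEnvier envyTestHalf ;; setNat 11 (cell 25) (.lit 0) (.sub (cell 4) (.lit 1)) ;;
      ite (pos (cell 4)) (setNat 13 (cell 25) (.lit 0) (.lit 0))
        (setNat 13 (cell 25) (.lit 0) (.lit 1)))

/-- Set all popularities to zero. -/
def clearCounts : SProg := count 25 .agents (setNat 16 (cell 25) (.lit 0) (.lit 0))

/-- Compute the champions with respect to the good in cell `24`. -/
def findChampions : SProg :=
  count 25 .agents
    (ite (pos (.read 13 (cell 25) (.lit 0)))
      (extendBundle ;; reduce ;;
        setNat 14 (cell 25) (.lit 0) (.sub (cell 5) (.lit 1)) ;;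
        copyRow 15 (cell 25) 3 (.lit 0) ;;
        setNat 16 (.read 14 (cell 25) (.lit 0)) (.lit 0)
          (.add (.read 16 (.read 14 (cell 25) (.lit 0)) (.lit 0)) (.lit 1))) skip)

/-- Compute the most popular champion. -/
def findBest : SProg :=
  setNat 17 (.lit 0) (.lit 0) (.lit 0) ;;
  count 25 .agents
    (ite (.ltNat (.read 16 (cell 17) (.lit 0)) (.read 16 (cell 25) (.lit 0)))
      (setNat 17 (.lit 0) (.lit 0) (cell 25)) skip)

/-- Let the most popular champion be the taker of the bundles that it is champion of. -/
def assignBest : SProg :=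
  count 25 .agents
    (ite (.conj (pos (.read 13 (cell 25) (.lit 0)))
        (.conj (.neg (.ltNat (.read 14 (cell 25) (.lit 0)) (cell 17)))
          (.neg (.ltNat (cell 17) (.read 14 (cell 25) (.lit 0))))))
      (setNat 13 (cell 25) (.lit 0) (.lit 0) ;; setNat 11 (cell 25) (.lit 0) (cell 17) ;;
        copyRow 12 (cell 25) 15 (cell 25)) skip)

/-- The greedy choice of champions. -/
def greedy : SProg :=
  initGreedy ;;
  count 24 .goods
    (ite (pos (.read 1 (.lit 0) (cell 24)))
      (clearCounts ;; findChampions ;; findBest ;; assignBest) skip)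

/-- Check whether every bundle has a taker. -/
def checkTotal : SProg :=
  setNat 19 (.lit 0) (.lit 0) (.lit 0) ;;
  count 25 .agents
    (ite (pos (.read 13 (cell 25) (.lit 0))) (setNat 19 (.lit 0) (.lit 0) (.lit 1)) skip)

/-- Reach a cycle of the takers. -/
def findCycle : SProg :=
  setNat 18 (.lit 0) (.lit 0) (.lit 0) ;;
  count 24 .agents (setNat 18 (.lit 0) (.lit 0) (.read 11 (cell 18) (.lit 0)))

/-- Hand over the bundles on the cycle. -/
def rotateCycle : SProg :=
  count 24 .agents
    (copyRow 0 (.read 11 (cell 18) (.lit 0)) 12 (cell 18) ;;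
      setNat 18 (.lit 0) (.lit 0) (.read 11 (cell 18) (.lit 0)))

/-- Improve the allocation if possible. -/
def improve : SProg :=
  ite (pos (cell 6)) (copyRow 0 (.sub (cell 6) (.lit 1)) 7 (.lit 0))
    (ite (pos (cell 8)) (setNat 0 (cell 9) (cell 10) (.lit 1))
      (ite (pos (cell 19)) (setNat 2 (.lit 0) (.lit 0) (.lit 1)) (findCycle ;; rotateCycle)))

/-- One round of the algorithm. -/
def round : SProg :=
  computePool ;; reducePool ;; findAddable ;; greedy ;; checkTotal ;; improve

theorem wf_round : round.wf = true := by rfl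

/-! ### The parts of a round -/

/-- The goods at which a row of an array is nonzero. -/
def supp (I : Input) (f : ℕ → ℕ) : Finset ℕ := (range I.numGoods).filter fun g => 0 < f g

/-- The allocation in the memory. -/
def alloc (I : Input) (s : Memory) : ℕ → Finset ℕ := fun i => supp I (s.nat 0 i)

theorem mem_supp {I : Input} {f : ℕ → ℕ} {g : ℕ} : g ∈ supp I f ↔ g < I.numGoods ∧ 0 < f g := by
  simp [supp]

theorem supp_subset (I : Input) (f : ℕ → ℕ) : supp I f ⊆ range I.numGoods := filter_subset _ _

/-- `hdi` and `hsi` express that the row indices do not change while the loop writes into `dst` and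
its counter array 20. Only supports are compared because cells beyond the goods are not copied. -/
theorem copyRow_spec (I : Input) (s : Memory) {dst src : ℕ} {di si : NExp} (i i' : ℕ)
    (h1 : dst ≠ 20) (h2 : src ≠ 20) (h3 : src ≠ dst)
    (hdi : ∀ s' : Memory, (∀ a, a ≠ dst → a ≠ 20 → s'.nat a = s.nat a) → di.eval I s' = i)
    (hsi : ∀ s' : Memory, (∀ a, a ≠ dst → a ≠ 20 → s'.nat a = s.nat a) → si.eval I s' = i') :
    supp I (((copyRow dst di src si).sem I s).nat dst i) = supp I (s.nat src i') ∧
      ∀ j, j ≠ i → ((copyRow dst di src si).sem I s).nat dst j = s.nat dst j := by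
  generalize he : (copyRow dst di src si).sem I s = s'
  refine count_induction he (fun k s' => (∀ a, a ≠ dst → a ≠ 20 → s'.nat a = s.nat a) ∧
    (∀ g < k, s'.nat dst i g = s.nat src i' g) ∧ ∀ j, j ≠ i → s'.nat dst j = s.nat dst j) ?_ ?_ ?_
  · exact ⟨fun _ _ _ => rfl, by simp, fun _ _ => rfl⟩
  · rintro k hk s1 ⟨e1, e2, e3⟩
    have hf : ∀ a, a ≠ dst → a ≠ 20 → (s1.setNat 20 0 0 k).nat a = s.nat a := by
      intro a ha ha'
      rw [nat_setNat_of_ne _ _ _ _ ha'.symm, e1 a ha ha']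
    have hd := hdi _ hf
    have hs := hsi _ hf
    simp only [sem, NExp.eval, hd, hs]
    refine ⟨?_, ?_, ?_⟩
    · intro a ha ha'
      rw [nat_setNat_of_ne _ _ _ _ ha.symm, hf a ha ha']
    · intro g hg
      by_cases hgk : g = k
      · subst hgk; simp [h2, e1 src h3 h2]
      · simp [hgk, h1, e2 g (by omega)]
    · intro j hj
      funext g
      simp [hj, h1, e3 j hj]
  · rintro s1 ⟨e1, e2, e3⟩ rfl
    rw [nat_setNat_of_ne _ _ _ _ h1.symm]
    refine ⟨?_, e3⟩
    ext g
    simp only [mem_supp]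
    refine and_congr_right fun hg => ?_
    rw [e2 g hg]

theorem sum_filter_range_succ (f : ℕ → ℕ) (w : ℕ → ℝ) (k : ℕ) :
    ∑ g ∈ (range (k + 1)).filter (fun g => 0 < f g), w g =
      ∑ g ∈ (range k).filter (fun g => 0 < f g), w g + if 0 < f k then w k else 0 := by
  rw [sum_filter, sum_range_succ, sum_filter]

@[simp] theorem sem_skip (I : Input) (s : Memory) : skip.sem I s = s := rfl

@[simp] theorem sem_setNat (I : Input) (s : Memory) (a : ℕ) (i j e : NExp) :
    (setNat a i j e).sem I s = s.setNat a (i.eval I s) (j.eval I s) (e.eval I s) := rfl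

@[simp] theorem sem_setReal (I : Input) (s : Memory) (a : ℕ) (i j : NExp) (e : RExp) :
    (setReal a i j e).sem I s = s.setReal a (i.eval I s) (j.eval I s) (e.eval I s) := rfl

@[simp] theorem sem_seq (I : Input) (s : Memory) (c d : SProg) :
    (c ;; d).sem I s = d.sem I (c.sem I s) := rfl

open Classical in
@[simp] theorem sem_ite (I : Input) (s : Memory) (b : Test) (c d : SProg) :
    (ite b c d).sem I s = if b.Holds I s then c.sem I s else d.sem I s := rfl

theorem sumValues_spec (I : Input) (s : Memory) :
    (sumValues.sem I s).real 0 0 0 =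
        s.real 0 0 0 + I.val (s.nat 21 0 0) (supp I (s.nat 3 0)) ∧
      (sumValues.sem I s).real 1 0 0 =
        s.real 1 0 0 + I.val (s.nat 21 0 0) (alloc I s (s.nat 21 0 0)) := by
  generalize he : sumValues.sem I s = s'
  refine count_induction he (fun k s' => (∀ a, a ≠ 22 → s'.nat a = s.nat a) ∧
    s'.real 0 0 0 = s.real 0 0 0 +
      ∑ g ∈ (range k).filter (fun g => 0 < s.nat 3 0 g), I.value (s.nat 21 0 0) g ∧
    s'.real 1 0 0 = s.real 1 0 0 +
      ∑ g ∈ (range k).filter (fun g => 0 < s.nat 0 (s.nat 21 0 0) g), I.value (s.nat 21 0 0) g)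
    ?_ ?_ ?_
  · exact ⟨fun _ _ => rfl, by simp, by simp⟩
  · rintro k hk s1 ⟨e1, e2, e3⟩
    refine ⟨?_, ?_, ?_⟩
    · intro a ha
      rw [nat_sem_of_not_writes I _ _ (by simp [writesNat]), nat_setNat_of_ne _ _ _ _ ha.symm,
        e1 a ha]
    all_goals
      rw [sum_filter_range_succ]
      simp only [sem, Test.Holds, NExp.eval, RExp.eval]
      by_cases hp : 0 < s.nat 3 0 k <;> by_cases hq : 0 < s.nat 0 (s.nat 21 0 0) k <;>
        simp [e1, e2, e3, hp, hq, add_assoc]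
  · rintro s1 ⟨-, e2, e3⟩ rfl
    exact ⟨e2, e3⟩

theorem envyTest_holds (I : Input) (s : Memory) :
    envyTest.Holds I s ↔ s.real 1 0 0 < (1 - I.eps) * s.real 0 0 0 := by
  simp only [envyTest, Test.Holds, RExp.eval, NExp.eval]
  rw [sub_mul, one_mul]

/-- The test compares doubled quantities, which avoids dividing by 2. -/
theorem envyTestHalf_holds (I : Input) (s : Memory) :
    envyTestHalf.Holds I s ↔ s.real 1 0 0 < (1 - I.eps / 2) * s.real 0 0 0 := by
  simp only [envyTestHalf, Test.Holds, RExp.eval, NExp.eval]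
  constructor <;> intro h <;> linarith

/-- The search does not stop at a hit; a later envier overwrites an earlier one. Storing the index
plus one lets 0 mean that there is none. -/
theorem findEnvier_spec {I : Input} {θ : ℝ} {b : Test}
    (hb : ∀ s : Memory, b.Holds I s ↔ s.real 1 0 0 < (1 - θ) * s.real 0 0 0) (s : Memory) :
    (((findEnvier b).sem I s).nat 4 0 0 = 0 ∧
        ∀ i < I.numAgents, ¬ Envies I θ (alloc I s) i (supp I (s.nat 3 0))) ∨
      ∃ i < I.numAgents, ((findEnvier b).sem I s).nat 4 0 0 = i + 1 ∧
        Envies I θ (alloc I s) i (supp I (s.nat 3 0)) := by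
  generalize he : (findEnvier b).sem I s = s'
  rw [findEnvier, sem_seq] at he
  refine count_induction he (fun k s' =>
    (∀ a, a ≠ 4 → a ≠ 21 → a ≠ 22 → s'.nat a = s.nat a) ∧
    ((s'.nat 4 0 0 = 0 ∧ ∀ i < k, ¬ Envies I θ (alloc I s) i (supp I (s.nat 3 0))) ∨
      ∃ i < I.numAgents, s'.nat 4 0 0 = i + 1 ∧
        Envies I θ (alloc I s) i (supp I (s.nat 3 0)))) ?_ ?_ ?_
  · exact ⟨fun a ha _ _ => nat_setNat_of_ne _ _ _ _ ha.symm, Or.inl ⟨by simp [NExp.eval], by simp⟩⟩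
  · rintro k hk s1 ⟨e1, e2⟩
    simp only [sem_seq, sem_setReal, NExp.eval]
    set s2 := ((s1.setNat 21 0 0 k).setReal 0 0 0
      ((RExp.lit 0).eval I (s1.setNat 21 0 0 k))).setReal 1 0 0
        ((RExp.lit 0).eval I ((s1.setNat 21 0 0 k).setReal 0 0 0
          ((RExp.lit 0).eval I (s1.setNat 21 0 0 k)))) with hs2
    have hn2 : s2.nat = (s1.setNat 21 0 0 k).nat := rfl
    have h21 : s2.nat 21 0 0 = k := by simp [hn2]
    have hf : ∀ a, a ≠ 4 → a ≠ 21 → a ≠ 22 → s2.nat a = s.nat a := by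
      intro a h4 h21 h22
      rw [hn2, nat_setNat_of_ne _ _ _ _ h21.symm, e1 a h4 h21 h22]
    obtain ⟨r0, r1⟩ := sumValues_spec I s2
    have hr0 : s2.real 0 0 0 = 0 := by simp [hs2, RExp.eval]
    have hr1 : s2.real 1 0 0 = 0 := by simp [hs2, RExp.eval]
    have hal : alloc I s2 k = alloc I s k := by unfold alloc; rw [hf 0] <;> decide
    rw [h21, hr0, zero_add, hf 3 (by decide) (by decide) (by decide)] at r0
    rw [h21, hr1, zero_add, hal] at r1
    have hf3 : ∀ a, a ≠ 22 → (sumValues.sem I s2).nat a = s2.nat a := fun a ha =>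
      nat_sem_of_not_writes I _ _ (by simp [writesNat, sumValues, ha.symm])
    generalize sumValues.sem I s2 = s3 at *
    have hh : b.Holds I s3 ↔ Envies I θ (alloc I s) k (supp I (s.nat 3 0)) := by
      rw [hb, r0, r1, Envies]
    simp only [sem_ite, sem_setNat, sem_skip, NExp.eval]
    by_cases hB : b.Holds I s3
    · rw [if_pos hB]
      refine ⟨?_, Or.inr ⟨k, hk, ?_, hh.1 hB⟩⟩
      · intro a h4 h21 h22
        rw [nat_setNat_of_ne _ _ _ _ h4.symm, hf3 a h22, hf a h4 h21 h22]
      · simp [hf3 21 (by decide), h21]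
    · rw [if_neg hB]
      refine ⟨fun a h4 h21 h22 => by rw [hf3 a h22, hf a h4 h21 h22], ?_⟩
      rw [hf3 4 (by decide), hn2, nat_setNat_of_ne _ _ _ _ (by decide)]
      refine e2.imp_left fun h => ⟨h.1, fun i hi => ?_⟩
      rcases Nat.lt_succ_iff_lt_or_eq.1 hi with hi | rfl
      · exact h.2 i hi
      · rwa [← hh]
  · rintro s1 ⟨-, e2⟩ rfl
    rwa [nat_setNat_of_ne _ _ _ _ (by decide)]

theorem supp_setNat_zero (I : Input) (s : Memory) (a i g : ℕ) :
    supp I ((s.setNat a i g 0).nat a i) = (supp I (s.nat a i)).erase g := by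
  ext h
  simp only [mem_supp, nat_setNat, mem_erase, true_and]
  by_cases hg : h = g <;> simp [hg]

theorem supp_setNat_one (I : Input) (s : Memory) {a i g : ℕ} (hg : g < I.numGoods) :
    supp I ((s.setNat a i g 1).nat a i) = insert g (supp I (s.nat a i)) := by
  ext h
  simp only [mem_supp, nat_setNat, mem_insert, true_and]
  by_cases hg' : h = g <;> simp [hg', hg]

/-- One pass over the goods suffices because envy is monotone in the set: a good whose removal left
no envier stays indispensable after further removals. The champion is the envier found at the last
successful removal, or at the start. -/
theorem reduce_spec {I : Input} (hI : I.Valid) (s : Memory) :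
    ((reduce.sem I s).nat 5 0 0 = 0 ∧ supp I ((reduce.sem I s).nat 3 0) = supp I (s.nat 3 0) ∧
        ∀ i < I.numAgents, ¬ Envies I I.eps (alloc I s) i (supp I (s.nat 3 0))) ∨
      ∃ c < I.numAgents, (reduce.sem I s).nat 5 0 0 = c + 1 ∧
        supp I ((reduce.sem I s).nat 3 0) ⊆ supp I (s.nat 3 0) ∧
        Envies I I.eps (alloc I s) c (supp I ((reduce.sem I s).nat 3 0)) ∧
        ∀ h ∈ supp I ((reduce.sem I s).nat 3 0), ∀ i < I.numAgents,
          ¬ Envies I I.eps (alloc I s) i ((supp I ((reduce.sem I s).nat 3 0)).erase h) := by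
  generalize he : reduce.sem I s = s'
  have hw : ∀ a, a ≠ 4 → a ≠ 21 → a ≠ 22 → (findEnvier envyTest).writesNat a = false := by
    intro a h1 h2 h3
    simp [writesNat, findEnvier, sumValues, h1.symm, h2.symm, h3.symm]
  have hle : I.eps ≤ 1 := by linarith [hI.eps_le]
  rw [reduce, sem_seq, sem_seq] at he
  refine count_induction he (fun k s' =>
    (∀ a, a ≠ 3 → a ≠ 4 → a ≠ 5 → a ≠ 21 → a ≠ 22 → a ≠ 23 → s'.nat a = s.nat a) ∧
    ((s'.nat 5 0 0 = 0 ∧ supp I (s'.nat 3 0) = supp I (s.nat 3 0) ∧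
        ∀ i < I.numAgents, ¬ Envies I I.eps (alloc I s) i (supp I (s.nat 3 0))) ∨
      ∃ c < I.numAgents, s'.nat 5 0 0 = c + 1 ∧ supp I (s'.nat 3 0) ⊆ supp I (s.nat 3 0) ∧
        Envies I I.eps (alloc I s) c (supp I (s'.nat 3 0)) ∧
        ∀ h ∈ supp I (s'.nat 3 0), h < k → ∀ i < I.numAgents,
          ¬ Envies I I.eps (alloc I s) i ((supp I (s'.nat 3 0)).erase h))) ?_ ?_ ?_
  · have h1 := findEnvier_spec (envyTest_holds I) s
    have hf := fun a h1 h2 h3 => nat_sem_of_not_writes I _ s (hw a h1 h2 h3)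
    generalize (findEnvier envyTest).sem I s = s1 at *
    simp only [sem_setNat, NExp.eval]
    have h3 : (s1.setNat 5 0 0 (s1.nat 4 0 0)).nat 3 = s.nat 3 := by
      rw [nat_setNat_of_ne _ _ _ _ (by decide), hf 3 (by decide) (by decide) (by decide)]
    rw [h3]
    refine ⟨?_, ?_⟩
    · intro a _ h4 h5 h21 h22 _
      rw [nat_setNat_of_ne _ _ _ _ h5.symm, hf a h4 h21 h22]
    · rcases h1 with ⟨h1, h2⟩ | ⟨c, hc, h1, h2⟩
      · exact Or.inl ⟨by simp [h1], rfl, h2⟩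
      · exact Or.inr ⟨c, hc, by simp [h1], Subset.rfl, h2, by simp⟩
  · rintro k hk s1 ⟨e1, e2⟩
    simp only [sem_ite, Test.Holds, NExp.eval, sem_skip]
    set s2 := s1.setNat 23 0 0 k with hs2
    have h23 : s2.nat 23 0 0 = k := by simp [hs2]
    have hn2 : ∀ a, a ≠ 23 → s2.nat a = s1.nat a := fun a ha =>
      nat_setNat_of_ne _ _ _ _ ha.symm
    have hf2 : ∀ a, a ≠ 3 → a ≠ 4 → a ≠ 5 → a ≠ 21 → a ≠ 22 → a ≠ 23 → s2.nat a = s.nat a :=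
      fun a h3 h4 h5 h21 h22 h23 => by rw [hn2 a h23, e1 a h3 h4 h5 h21 h22 h23]
    rw [← hn2 3 (by decide), ← hn2 5 (by decide)] at e2
    clear_value s2
    simp only [h23]
    by_cases hp : 0 < s2.nat 3 0 k
    · rw [if_pos hp]
      simp only [sem_seq, sem_setNat, NExp.eval, h23]
      set s3 := s2.setNat 3 0 k 0 with hs3
      have hn3 : ∀ a, a ≠ 3 → s3.nat a = s2.nat a := fun a ha =>
        nat_setNat_of_ne _ _ _ _ ha.symm
      have hsup : supp I (s3.nat 3 0) = (supp I (s2.nat 3 0)).erase k := supp_setNat_zero ..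
      have hkm : k ∈ supp I (s2.nat 3 0) := mem_supp.2 ⟨hk, hp⟩
      have hal : alloc I s3 = alloc I s := by
        unfold alloc
        rw [hn3 0 (by decide), hf2 0] <;> decide
      have h23' : s3.nat 23 0 0 = k := by rw [hn3 23 (by decide), h23]
      have h1 := findEnvier_spec (envyTest_holds I) s3
      rw [hsup, hal] at h1
      have hf := fun a h1 h2 h3 => nat_sem_of_not_writes I _ s3 (hw a h1 h2 h3)
      generalize (findEnvier envyTest).sem I s3 = s4 at *
      have hf4 : ∀ a, a ≠ 3 → a ≠ 4 → a ≠ 5 → a ≠ 21 → a ≠ 22 → a ≠ 23 → s4.nat a = s.nat a :=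
        fun a h3 h4 h5 h21 h22 h23 => by rw [hf a h4 h21 h22, hn3 a h3, hf2 a h3 h4 h5 h21 h22 h23]
      have h43 : s4.nat 3 = s3.nat 3 := hf 3 (by decide) (by decide) (by decide)
      have h45 : s4.nat 5 = s2.nat 5 := by
        rw [hf 5 (by decide) (by decide) (by decide), hn3 5 (by decide)]
      have h423 : s4.nat 23 0 0 = k := by rw [hf 23 (by decide) (by decide) (by decide), h23']
      simp only [sem_ite, Test.Holds, sem_setNat, NExp.eval, h423]
      rcases h1 with ⟨h1, h2⟩ | ⟨c, hc, h1, h2⟩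
      · rw [if_neg (by omega)]
        -- Nobody envies the set without `k`, so `k` is put back; `h2` is then the minimality at
        -- `k`.
        have hback : supp I ((s4.setNat 3 0 k 1).nat 3 0) = supp I (s2.nat 3 0) := by
          rw [supp_setNat_one I s4 hk, h43, hsup, insert_erase hkm]
        rw [hback, nat_setNat_of_ne _ _ _ _ (by decide), h45]
        refine ⟨?_, ?_⟩
        · intro a h3 h4 h5 h21 h22 h23
          rw [nat_setNat_of_ne _ _ _ _ h3.symm, hf4 a h3 h4 h5 h21 h22 h23]
        · refine e2.imp_right ?_
          rintro ⟨c, hc, f1, f2, f3, f4⟩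
          refine ⟨c, hc, f1, f2, f3, fun h hh hhk => ?_⟩
          rcases Nat.lt_succ_iff_lt_or_eq.1 hhk with hhk | rfl
          · exact f4 h hh hhk
          · exact h2
      · rw [if_pos (by omega), h1]
        rw [nat_setNat_of_ne (a' := 3) _ _ _ _ (by decide), h43, hsup]
        have hsub : supp I (s2.nat 3 0) ⊆ supp I (s.nat 3 0) := by
          rcases e2 with ⟨-, f, -⟩ | ⟨-, -, -, f, -⟩
          · exact f.subset
          · exact f
        refine ⟨?_, Or.inr ⟨c, hc, by simp, (erase_subset _ _).trans hsub, h2, ?_⟩⟩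
        · intro a h3 h4 h5 h21 h22 h23
          rw [nat_setNat_of_ne _ _ _ _ h5.symm, hf4 a h3 h4 h5 h21 h22 h23]
        · intro h hh hhk i hi henv
          obtain ⟨hne, hh⟩ := mem_erase.1 hh
          rcases e2 with ⟨-, f, f'⟩ | ⟨c', hc', f1, f2, f3, f4⟩
          · exact f' i hi (henv.mono hI hle
              (((erase_subset _ _).trans (erase_subset _ _)).trans f.subset))
          · exact f4 h hh (by omega) i hi
              (henv.mono hI hle (erase_subset_erase _ (erase_subset _ _)))
    · rw [if_neg hp]
      refine ⟨hf2, e2.imp_right ?_⟩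
      rintro ⟨c, hc, f1, f2, f3, f4⟩
      refine ⟨c, hc, f1, f2, f3, fun h hh hhk => ?_⟩
      rcases Nat.lt_succ_iff_lt_or_eq.1 hhk with hhk | rfl
      · exact f4 h hh hhk
      · exact absurd (mem_supp.1 hh).2 hp
  · rintro s1 ⟨-, e2⟩ rfl
    rw [nat_setNat_of_ne _ _ _ _ (by decide), nat_setNat_of_ne _ _ _ _ (by decide)]
    refine e2.imp_right ?_
    rintro ⟨c, hc, f1, f2, f3, f4⟩
    exact ⟨c, hc, f1, f2, f3, fun h hh => f4 h hh (mem_range.1 (supp_subset I _ hh))⟩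

/-! ### The pool and the search for the two simple improvements -/

theorem computePool_spec (I : Input) (s : Memory) :
    supp I ((computePool.sem I s).nat 1 0) = I.pool (alloc I s) := by
  generalize he : computePool.sem I s = s'
  refine count_induction he (fun k s' => s'.nat 0 = s.nat 0 ∧
    ∀ g < k, 0 < s'.nat 1 0 g ↔ ∀ i < I.numAgents, ¬ 0 < s.nat 0 i g) ?_ ?_ ?_
  · simp
  · rintro k hk s1 ⟨e1, e2⟩
    rw [sem_seq]
    generalize hi : sem I (count _ _ _) _ = s2
    refine count_induction hi (fun r s' => s'.nat 0 = s.nat 0 ∧ s'.nat 24 0 0 = k ∧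
      (∀ g < k, 0 < s'.nat 1 0 g ↔ ∀ i < I.numAgents, ¬ 0 < s.nat 0 i g) ∧
      (0 < s'.nat 1 0 k ↔ ∀ i < r, ¬ 0 < s.nat 0 i k)) ?_ ?_ ?_
    · simp only [sem_setNat, NExp.eval]
      refine ⟨by simpa [nat_setNat_of_ne] using e1, by simp, fun g hg => ?_, by simp⟩
      rw [← e2 g hg]
      simp [hg.ne]
    · rintro r hr s3 ⟨f1, f2, f3, f4⟩
      simp only [sem_ite, Test.Holds, NExp.eval, sem_skip, sem_setNat]
      have h25 : (s3.setNat 25 0 0 r).nat 25 0 0 = r := by simp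
      have hn : ∀ a, a ≠ 25 → (s3.setNat 25 0 0 r).nat a = s3.nat a := fun a ha =>
        nat_setNat_of_ne _ _ _ _ ha.symm
      simp only [h25, hn 24 (by decide), hn 0 (by decide), f1, f2]
      by_cases hp : 0 < s.nat 0 r k
      · rw [if_pos hp]
        refine ⟨?_, ?_, ?_, ?_⟩
        · rw [nat_setNat_of_ne _ _ _ _ (by decide), hn 0 (by decide), f1]
        · rw [nat_setNat_of_ne _ _ _ _ (by decide), hn 24 (by decide), f2]
        · intro g hg
          rw [← f3 g hg]
          simp [hg.ne]
        · simp only [nat_setNat, and_self, if_true, lt_irrefl, false_iff]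
          exact fun h => h r (by omega) hp
      · rw [if_neg hp]
        refine ⟨by rw [hn 0 (by decide), f1], by rw [hn 24 (by decide), f2],
          by rw [hn 1 (by decide)]; exact f3, ?_⟩
        rw [hn 1 (by decide), f4]
        refine ⟨fun h i hi => ?_, fun h i hi => h i (by omega)⟩
        rcases Nat.lt_succ_iff_lt_or_eq.1 hi with hi | rfl
        · exact h i hi
        · exact hp
    · rintro s3 ⟨f1, f2, f3, f4⟩ rfl
      rw [nat_setNat_of_ne _ _ _ _ (by decide), nat_setNat_of_ne _ _ _ _ (by decide)]
      refine ⟨f1, fun g hg => ?_⟩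
      rcases Nat.lt_succ_iff_lt_or_eq.1 hg with hg | rfl
      · exact f3 g hg
      · exact f4
  · rintro s1 ⟨-, e2⟩ rfl
    ext g
    rw [nat_setNat_of_ne _ _ _ _ (by decide), mem_supp, mem_pool]
    refine and_congr_right fun hg => ?_
    rw [e2 g hg]
    refine forall₂_congr fun i _ => ?_
    rw [alloc, mem_supp]
    tauto

theorem reducePool_spec {I : Input} (hI : I.Valid) (s : Memory) :
    ((reducePool.sem I s).nat 6 0 0 = 0 ∧
        ∀ i < I.numAgents, ¬ Envies I I.eps (alloc I s) i (supp I (s.nat 1 0))) ∨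
      ∃ c < I.numAgents, (reducePool.sem I s).nat 6 0 0 = c + 1 ∧
        supp I ((reducePool.sem I s).nat 7 0) ⊆ supp I (s.nat 1 0) ∧
        Envies I I.eps (alloc I s) c (supp I ((reducePool.sem I s).nat 7 0)) ∧
        ∀ h ∈ supp I ((reducePool.sem I s).nat 7 0), ∀ i < I.numAgents,
          ¬ Envies I I.eps (alloc I s) i ((supp I ((reducePool.sem I s).nat 7 0)).erase h) := by
  rw [reducePool]
  simp only [sem_seq]
  have h1 := (copyRow_spec I s (dst := 3) (di := .lit 0) (src := 1) (si := .lit 0) 0 0 (by decide)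
    (by decide) (by decide) (fun _ _ => rfl) (fun _ _ => rfl)).1
  have h10 : ((copyRow 3 (.lit 0) 1 (.lit 0)).sem I s).nat 0 = s.nat 0 :=
    nat_sem_of_not_writes I _ _ rfl
  generalize (copyRow 3 (.lit 0) 1 (.lit 0)).sem I s = s1 at *
  have h2 := reduce_spec hI s1
  have hal : alloc I s1 = alloc I s := by unfold alloc; rw [h10]
  rw [hal, h1] at h2
  generalize reduce.sem I s1 = s2 at *
  simp only [sem_setNat, NExp.eval]
  set s3 := s2.setNat 6 0 0 (s2.nat 5 0 0) with hs3
  have h4 := (copyRow_spec I s3 (dst := 7) (di := .lit 0) (src := 3) (si := .lit 0) 0 0 (by decide)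
    (by decide) (by decide) (fun _ _ => rfl) (fun _ _ => rfl)).1
  have h46 : ((copyRow 7 (.lit 0) 3 (.lit 0)).sem I s3).nat 6 0 0 = s2.nat 5 0 0 := by
    rw [nat_sem_of_not_writes I _ _ rfl]; simp [hs3]
  rw [hs3, nat_setNat_of_ne _ _ _ _ (by decide), ← hs3] at h4
  rw [h46, h4]
  rcases h2 with ⟨f1, -, f2⟩ | h2
  · exact Or.inl ⟨f1, f2⟩
  · exact Or.inr h2

theorem extendBundle_spec {I : Input} (s : Memory) (hg : s.nat 24 0 0 < I.numGoods) :
    supp I ((extendBundle.sem I s).nat 3 0) =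
      insert (s.nat 24 0 0) (alloc I s (s.nat 25 0 0)) := by
  rw [extendBundle, sem_seq]
  have h1 := (copyRow_spec I s (dst := 3) (di := .lit 0) (src := 0) (si := cell 25) 0
    (s.nat 25 0 0) (by decide) (by decide) (by decide) (fun _ _ => rfl)
    (fun s' h => by simp only [NExp.eval, h 25 (by decide) (by decide)])).1
  have h24 : ((copyRow 3 (.lit 0) 0 (cell 25)).sem I s).nat 24 = s.nat 24 :=
    nat_sem_of_not_writes I _ _ rfl
  generalize (copyRow 3 (.lit 0) 0 (cell 25)).sem I s = s1 at *
  simp only [sem_setNat, NExp.eval, h24]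
  rw [supp_setNat_one I _ hg, h1]
  rfl

/-- The first alternative is the hypothesis under which the greedy choice finds a champion for every
bundle and pool good. -/
theorem findAddable_spec (I : Input) (s : Memory) :
    ((findAddable.sem I s).nat 8 0 0 = 0 ∧ ∀ g ∈ supp I (s.nat 1 0), ∀ j < I.numAgents,
        ∃ i < I.numAgents, Envies I I.eps (alloc I s) i (insert g (alloc I s j))) ∨
      ((findAddable.sem I s).nat 8 0 0 = 1 ∧ (findAddable.sem I s).nat 9 0 0 < I.numAgents ∧
        (findAddable.sem I s).nat 10 0 0 ∈ supp I (s.nat 1 0) ∧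
        ∀ i < I.numAgents, ¬ Envies I I.eps (alloc I s) i (insert
          ((findAddable.sem I s).nat 10 0 0) (alloc I s ((findAddable.sem I s).nat 9 0 0)))) := by
  generalize he : findAddable.sem I s = s'
  rw [findAddable, sem_seq] at he
  refine count_induction he (fun k s' => s'.nat 0 = s.nat 0 ∧ s'.nat 1 = s.nat 1 ∧
    ((s'.nat 8 0 0 = 0 ∧ ∀ g ∈ supp I (s.nat 1 0), g < k → ∀ j < I.numAgents,
        ∃ i < I.numAgents, Envies I I.eps (alloc I s) i (insert g (alloc I s j))) ∨
      (s'.nat 8 0 0 = 1 ∧ s'.nat 9 0 0 < I.numAgents ∧ s'.nat 10 0 0 ∈ supp I (s.nat 1 0) ∧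
        ∀ i < I.numAgents, ¬ Envies I I.eps (alloc I s) i (insert
          (s'.nat 10 0 0) (alloc I s (s'.nat 9 0 0)))))) ?_ ?_ ?_
  · exact ⟨rfl, rfl, Or.inl ⟨by simp [NExp.eval], by simp⟩⟩
  · rintro k hk s1 ⟨e0, e1, e2⟩
    set s2 := s1.setNat 24 0 0 k with hs2
    have hn2 : ∀ a, a ≠ 24 → s2.nat a = s1.nat a := fun a ha => nat_setNat_of_ne _ _ _ _ ha.symm
    have h24 : s2.nat 24 0 0 = k := by simp [hs2]
    rw [← hn2 0 (by decide)] at e0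
    rw [← hn2 1 (by decide)] at e1
    rw [← hn2 8 (by decide), ← hn2 9 (by decide), ← hn2 10 (by decide)] at e2
    clear_value s2
    simp only [sem_ite, Test.Holds, NExp.eval, sem_skip, h24, e1]
    by_cases hp : 0 < s.nat 1 0 k
    · rw [if_pos hp]
      have hkm : k ∈ supp I (s.nat 1 0) := mem_supp.2 ⟨hk, hp⟩
      generalize hi : sem I (count _ _ _) _ = s3
      refine count_induction hi (fun r s' => s'.nat 0 = s.nat 0 ∧ s'.nat 1 = s.nat 1 ∧
        s'.nat 24 0 0 = k ∧
        ((s'.nat 8 0 0 = 0 ∧ (∀ g ∈ supp I (s.nat 1 0), g < k → ∀ j < I.numAgents,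
            ∃ i < I.numAgents, Envies I I.eps (alloc I s) i (insert g (alloc I s j))) ∧
            ∀ j < r, ∃ i < I.numAgents, Envies I I.eps (alloc I s) i (insert k (alloc I s j))) ∨
          (s'.nat 8 0 0 = 1 ∧ s'.nat 9 0 0 < I.numAgents ∧ s'.nat 10 0 0 ∈ supp I (s.nat 1 0) ∧
            ∀ i < I.numAgents, ¬ Envies I I.eps (alloc I s) i (insert
              (s'.nat 10 0 0) (alloc I s (s'.nat 9 0 0)))))) ?_ ?_ ?_
      · exact ⟨e0, e1, h24, e2.imp_left fun h => ⟨h.1, h.2, by simp⟩⟩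
      · rintro r hr s4 ⟨f0, f1, f24, f2⟩
        set s5 := s4.setNat 25 0 0 r with hs5
        have hn5 : ∀ a, a ≠ 25 → s5.nat a = s4.nat a :=
          fun a ha => nat_setNat_of_ne _ _ _ _ ha.symm
        have h25 : s5.nat 25 0 0 = r := by simp [hs5]
        rw [← hn5 0 (by decide)] at f0
        rw [← hn5 1 (by decide)] at f1
        rw [← hn5 24 (by decide)] at f24
        rw [← hn5 8 (by decide), ← hn5 9 (by decide), ← hn5 10 (by decide)] at f2
        clear_value s5
        have hal5 : alloc I s5 = alloc I s := by unfold alloc; rw [f0]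
        simp only [sem_seq]
        have hx := extendBundle_spec (I := I) s5 (by rw [f24]; exact hk)
        have hxf : ∀ a, a ≠ 3 → a ≠ 20 → (extendBundle.sem I s5).nat a = s5.nat a :=
          fun a h3 h20 => nat_sem_of_not_writes I _ _ (by
            simp [extendBundle, copyRow, writesNat, h3.symm, h20.symm])
        rw [h25, f24, hal5] at hx
        generalize extendBundle.sem I s5 = s6 at *
        have hal6 : alloc I s6 = alloc I s := by
          unfold alloc; rw [hxf 0 (by decide) (by decide), f0]
        have hy := findEnvier_spec (envyTest_holds I) s6
        rw [hx, hal6] at hy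
        have hyf : ∀ a, a ≠ 4 → a ≠ 21 → a ≠ 22 →
            ((findEnvier envyTest).sem I s6).nat a = s6.nat a :=
          fun a h4 h21 h22 => nat_sem_of_not_writes I _ _ (by
            simp [findEnvier, sumValues, writesNat, h4.symm, h21.symm, h22.symm])
        generalize (findEnvier envyTest).sem I s6 = s7 at *
        have hf : ∀ a, a ≠ 3 → a ≠ 4 → a ≠ 20 → a ≠ 21 → a ≠ 22 → s7.nat a = s5.nat a :=
          fun a h3 h4 h20 h21 h22 => by rw [hyf a h4 h21 h22, hxf a h3 h20]
        have g0 : s7.nat 0 = s.nat 0 := by rw [hf 0, f0] <;> decide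
        have g1 : s7.nat 1 = s.nat 1 := by rw [hf 1, f1] <;> decide
        have g24 : s7.nat 24 0 0 = k := by rw [hf 24, f24] <;> decide
        have g25 : s7.nat 25 0 0 = r := by rw [hf 25, h25] <;> decide
        rw [← hf 8 (by decide) (by decide) (by decide) (by decide) (by decide),
          ← hf 9 (by decide) (by decide) (by decide) (by decide) (by decide),
          ← hf 10 (by decide) (by decide) (by decide) (by decide) (by decide)] at f2
        simp only [sem_ite, Test.Holds, NExp.eval, sem_skip]
        rcases hy with ⟨hy1, hy2⟩ | ⟨i, hi, hy1, hy2⟩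
        · simp only [show ¬ 0 < s7.nat 4 0 0 by omega, if_false, sem_seq, sem_setNat, NExp.eval]
          refine ⟨?_, ?_, ?_, Or.inr ?_⟩
          · exact g0
          · exact g1
          · simp [g24]
          · simp only [nat_setNat, g24, g25]
            norm_num
            exact ⟨hr, hkm, hy2⟩
        · simp only [show 0 < s7.nat 4 0 0 by omega, if_true]
          refine ⟨g0, g1, g24, f2.imp_left fun h => ⟨h.1, h.2.1, fun j hj => ?_⟩⟩
          rcases Nat.lt_succ_iff_lt_or_eq.1 hj with hj | rfl
          · exact h.2.2 j hj
          · exact ⟨i, hi, hy2⟩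
      · rintro s4 ⟨f0, f1, -, f2⟩ rfl
        have hn : ∀ a, a ≠ 25 → (s4.setNat 25 0 0 (Dim.agents.size I)).nat a = s4.nat a :=
          fun a ha => nat_setNat_of_ne _ _ _ _ ha.symm
        rw [hn 0 (by decide), hn 1 (by decide), hn 8 (by decide), hn 9 (by decide),
          hn 10 (by decide)]
        refine ⟨f0, f1, f2.imp_left fun h => ⟨h.1, fun g hg hgk => ?_⟩⟩
        rcases Nat.lt_succ_iff_lt_or_eq.1 hgk with hgk | rfl
        · exact h.2.1 g hg hgk
        · exact h.2.2
    · rw [if_neg hp]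
      refine ⟨e0, e1, e2.imp_left fun h => ⟨h.1, fun g hg hgk => ?_⟩⟩
      rcases Nat.lt_succ_iff_lt_or_eq.1 hgk with hgk | rfl
      · exact h.2 g hg hgk
      · exact absurd (mem_supp.1 hg).2 hp
  · rintro s1 ⟨-, -, e2⟩ rfl
    have hn : ∀ a, a ≠ 24 → (s1.setNat 24 0 0 (Dim.goods.size I)).nat a = s1.nat a :=
      fun a ha => nat_setNat_of_ne _ _ _ _ ha.symm
    rw [hn 8 (by decide), hn 9 (by decide), hn 10 (by decide)]
    exact e2.imp_left fun h =>
      ⟨h.1, fun g hg => h.2 g hg (mem_range.1 (supp_subset I _ hg))⟩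

/-! ### The greedy choice of takers in memory -/

theorem initGreedy_spec (I : Input) (s : Memory) :
    ∀ j < I.numAgents,
      ((((initGreedy.sem I s).nat 13 j 0 = 0 ∧ (initGreedy.sem I s).nat 11 j 0 < I.numAgents ∧
          Envies I (I.eps / 2) (alloc I s) ((initGreedy.sem I s).nat 11 j 0) (alloc I s j)) ∨
        (0 < (initGreedy.sem I s).nat 13 j 0 ∧
          ∀ i < I.numAgents, ¬ Envies I (I.eps / 2) (alloc I s) i (alloc I s j))) ∧
      supp I ((initGreedy.sem I s).nat 12 j) = alloc I s j) := by
  generalize he : initGreedy.sem I s = s'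
  refine count_induction he (fun k s' => s'.nat 0 = s.nat 0 ∧ ∀ j < k,
      ((s'.nat 13 j 0 = 0 ∧ s'.nat 11 j 0 < I.numAgents ∧
          Envies I (I.eps / 2) (alloc I s) (s'.nat 11 j 0) (alloc I s j)) ∨
        (0 < s'.nat 13 j 0 ∧
          ∀ i < I.numAgents, ¬ Envies I (I.eps / 2) (alloc I s) i (alloc I s j))) ∧
      supp I (s'.nat 12 j) = alloc I s j) ?_ ?_ ?_
  · exact ⟨rfl, by simp⟩
  · rintro k hk s1 ⟨e0, e1⟩
    set s2 := s1.setNat 25 0 0 k with hs2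
    have hn2 : ∀ a, a ≠ 25 → s2.nat a = s1.nat a := fun a ha => nat_setNat_of_ne _ _ _ _ ha.symm
    have h25 : s2.nat 25 0 0 = k := by simp [hs2]
    rw [← hn2 0 (by decide)] at e0
    rw [← hn2 11 (by decide), ← hn2 12 (by decide), ← hn2 13 (by decide)] at e1
    clear_value s2
    simp only [sem_seq]
    have hx := (copyRow_spec I s2 (dst := 3) (di := .lit 0) (src := 0) (si := cell 25) 0 k
      (by decide) (by decide) (by decide) (fun _ _ => rfl)
      (fun s' h => by simp only [NExp.eval, h 25 (by decide) (by decide), h25])).1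
    have hxf : ∀ a, a ≠ 3 → a ≠ 20 → ((copyRow 3 (.lit 0) 0 (cell 25)).sem I s2).nat a = s2.nat a :=
      fun a h3 h20 => nat_sem_of_not_writes I _ _ (by
        simp [copyRow, writesNat, h3.symm, h20.symm])
    generalize (copyRow 3 (.lit 0) 0 (cell 25)).sem I s2 = s3 at *
    have hs3 : s3.nat 25 0 0 = k := by rw [hxf 25 (by decide) (by decide), h25]
    obtain ⟨hy, hy'⟩ := copyRow_spec I s3 (dst := 12) (di := cell 25) (src := 0) (si := cell 25) k k
      (by decide) (by decide) (by decide)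
      (fun s' h => by simp only [NExp.eval, h 25 (by decide) (by decide), hs3])
      (fun s' h => by simp only [NExp.eval, h 25 (by decide) (by decide), hs3])
    have hyf : ∀ a, a ≠ 12 → a ≠ 20 →
        ((copyRow 12 (cell 25) 0 (cell 25)).sem I s3).nat a = s3.nat a :=
      fun a h3 h20 => nat_sem_of_not_writes I _ _ (by
        simp [copyRow, writesNat, h3.symm, h20.symm])
    generalize (copyRow 12 (cell 25) 0 (cell 25)).sem I s3 = s4 at *
    have hz := findEnvier_spec (envyTestHalf_holds I) s4
    have hzf : ∀ a, a ≠ 4 → a ≠ 21 → a ≠ 22 →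
        ((findEnvier envyTestHalf).sem I s4).nat a = s4.nat a :=
      fun a h4 h21 h22 => nat_sem_of_not_writes I _ _ (by
        simp [findEnvier, sumValues, writesNat, h4.symm, h21.symm, h22.symm])
    have h40 : s4.nat 0 = s.nat 0 := by
      rw [hyf 0 (by decide) (by decide), hxf 0 (by decide) (by decide), e0]
    have hal : alloc I s4 = alloc I s := by unfold alloc; rw [h40]
    have h43 : supp I (s4.nat 3 0) = alloc I s k := by
      rw [hyf 3 (by decide) (by decide), hx, e0]; rfl
    have h412 : supp I (s4.nat 12 k) = alloc I s k := by
      rw [hy, hxf 0 (by decide) (by decide), e0]; rfl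
    rw [hal, h43] at hz
    generalize (findEnvier envyTestHalf).sem I s4 = s5 at *
    have f0 : s5.nat 0 = s.nat 0 := by rw [hzf 0 (by decide) (by decide) (by decide), h40]
    have f25 : s5.nat 25 0 0 = k := by
      rw [hzf 25 (by decide) (by decide) (by decide), hyf 25 (by decide) (by decide), hs3]
    have f11 : s5.nat 11 = s2.nat 11 := by
      rw [hzf 11 (by decide) (by decide) (by decide), hyf 11 (by decide) (by decide),
        hxf 11 (by decide) (by decide)]
    have f13 : s5.nat 13 = s2.nat 13 := by
      rw [hzf 13 (by decide) (by decide) (by decide), hyf 13 (by decide) (by decide),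
        hxf 13 (by decide) (by decide)]
    have f12 : ∀ j, j ≠ k → s5.nat 12 j = s2.nat 12 j := fun j hj => by
      rw [hzf 12 (by decide) (by decide) (by decide), hy' j hj, hxf 12 (by decide) (by decide)]
    have f12' : supp I (s5.nat 12 k) = alloc I s k := by
      rw [hzf 12 (by decide) (by decide) (by decide), h412]
    simp only [sem_ite, Test.Holds, NExp.eval, sem_setNat, f25]
    -- Both branches at once, `x` being the flag for membership in `U`. For an unenvied bundle the
    -- truncated subtraction stores the meaningless taker 0, which the flag masks.
    have key : ∀ x : ℕ, (0 < x ↔ ¬ 0 < s5.nat 4 0 0) →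
        ∀ s6 : Memory, s6 = (s5.setNat 11 k 0 (s5.nat 4 0 0 - 1)).setNat 13 k 0 x →
        s6.nat 0 = s.nat 0 ∧ ∀ j < k + 1,
        ((s6.nat 13 j 0 = 0 ∧ s6.nat 11 j 0 < I.numAgents ∧
            Envies I (I.eps / 2) (alloc I s) (s6.nat 11 j 0) (alloc I s j)) ∨
          (0 < s6.nat 13 j 0 ∧
            ∀ i < I.numAgents, ¬ Envies I (I.eps / 2) (alloc I s) i (alloc I s j))) ∧
        supp I (s6.nat 12 j) = alloc I s j := by
      rintro x hx0 s6 rfl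
      refine ⟨f0, fun j hj => ?_⟩
      have h12 : ((s5.setNat 11 k 0 (s5.nat 4 0 0 - 1)).setNat 13 k 0 x).nat 12 = s5.nat 12 := rfl
      rw [h12]
      rcases Nat.lt_succ_iff_lt_or_eq.1 hj with hj | rfl
      · have := e1 j hj
        rw [f12 j hj.ne]
        simpa [hj.ne, f11, f13] using this
      · refine ⟨?_, f12'⟩
        rcases hz with ⟨hz1, hz2⟩ | ⟨i, hi, hz1, hz2⟩
        · right
          refine ⟨?_, hz2⟩
          simp only [nat_setNat, and_self, if_true]
          omega
        · left
          have : x = 0 := by omega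
          subst this
          simp [hz1, hi, hz2]
    have hs6 : (s5.setNat 11 k 0 (s5.nat 4 0 0 - 1)).nat 4 0 0 = s5.nat 4 0 0 := by simp
    have hs6' : (s5.setNat 11 k 0 (s5.nat 4 0 0 - 1)).nat 25 0 0 = k := by simp [f25]
    simp only [hs6, hs6']
    by_cases h4 : 0 < s5.nat 4 0 0
    · simp only [h4, if_true]
      exact key 0 (by simp [h4]) _ rfl
    · simp only [h4, if_false]
      exact key 1 (by simp [h4]) _ rfl
  · rintro s1 ⟨-, e1⟩ rfl
    exact e1

theorem clearCounts_spec (I : Input) (s : Memory) :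
    ∀ t < I.numAgents, (clearCounts.sem I s).nat 16 t 0 = 0 := by
  generalize he : clearCounts.sem I s = s'
  refine count_induction he (fun k s' => ∀ t < k, s'.nat 16 t 0 = 0) ?_ ?_ ?_
  · simp
  · intro k hk s1 e1 t ht
    simp only [sem_setNat, NExp.eval, nat_setNat]
    norm_num
    intro hne
    exact e1 t (by omega)
  · rintro s1 e1 rfl t ht
    simpa using e1 t ht

theorem findChampions_spec {I : Input} (hI : I.Valid) (s : Memory)
    (hg : s.nat 24 0 0 < I.numGoods)
    (hno : ∀ j < I.numAgents, ∃ i < I.numAgents,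
      Envies I I.eps (alloc I s) i (insert (s.nat 24 0 0) (alloc I s j)))
    (hc : ∀ t < I.numAgents, s.nat 16 t 0 = 0) :
    (∀ j < I.numAgents, 0 < s.nat 13 j 0 →
      (findChampions.sem I s).nat 14 j 0 < I.numAgents ∧
      supp I ((findChampions.sem I s).nat 15 j) ⊆ insert (s.nat 24 0 0) (alloc I s j) ∧
      Envies I I.eps (alloc I s) ((findChampions.sem I s).nat 14 j 0)
        (supp I ((findChampions.sem I s).nat 15 j)) ∧
      ∀ h ∈ supp I ((findChampions.sem I s).nat 15 j), ∀ i < I.numAgents,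
        ¬ Envies I I.eps (alloc I s) i ((supp I ((findChampions.sem I s).nat 15 j)).erase h)) ∧
    ∀ t < I.numAgents, (findChampions.sem I s).nat 16 t 0 = ((range I.numAgents).filter
      fun j => 0 < s.nat 13 j 0 ∧ (findChampions.sem I s).nat 14 j 0 = t).card := by
  generalize he : findChampions.sem I s = s'
  refine count_induction he (fun k s' =>
    (s'.nat 0 = s.nat 0 ∧ s'.nat 13 = s.nat 13 ∧ s'.nat 24 = s.nat 24) ∧
    (∀ j < k, 0 < s.nat 13 j 0 →
      s'.nat 14 j 0 < I.numAgents ∧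
      supp I (s'.nat 15 j) ⊆ insert (s.nat 24 0 0) (alloc I s j) ∧
      Envies I I.eps (alloc I s) (s'.nat 14 j 0) (supp I (s'.nat 15 j)) ∧
      ∀ h ∈ supp I (s'.nat 15 j), ∀ i < I.numAgents,
        ¬ Envies I I.eps (alloc I s) i ((supp I (s'.nat 15 j)).erase h)) ∧
    ∀ t < I.numAgents, s'.nat 16 t 0 = ((range k).filter
      fun j => 0 < s.nat 13 j 0 ∧ s'.nat 14 j 0 = t).card) ?_ ?_ ?_
  · exact ⟨⟨rfl, rfl, rfl⟩, by simp, by simpa using hc⟩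
  · rintro k hk s1 ⟨⟨e0, e13, e24⟩, e1, e2⟩
    set s2 := s1.setNat 25 0 0 k with hs2
    have hn2 : ∀ a, a ≠ 25 → s2.nat a = s1.nat a := fun a ha => nat_setNat_of_ne _ _ _ _ ha.symm
    have h25 : s2.nat 25 0 0 = k := by simp [hs2]
    rw [← hn2 0 (by decide)] at e0
    rw [← hn2 13 (by decide)] at e13
    rw [← hn2 24 (by decide)] at e24
    rw [← hn2 14 (by decide), ← hn2 15 (by decide)] at e1
    rw [← hn2 14 (by decide), ← hn2 16 (by decide)] at e2
    clear_value s2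
    simp only [sem_ite, Test.Holds, NExp.eval, sem_skip, h25, e13]
    by_cases hp : 0 < s.nat 13 k 0
    · simp only [hp, if_true, sem_seq]
      have hx := extendBundle_spec (I := I) s2 (by rw [e24]; exact hg)
      have hxf : ∀ a, a ≠ 3 → a ≠ 20 → (extendBundle.sem I s2).nat a = s2.nat a :=
        fun a h3 h20 => nat_sem_of_not_writes I _ _ (by
          simp [extendBundle, copyRow, writesNat, h3.symm, h20.symm])
      have hal2 : alloc I s2 = alloc I s := by unfold alloc; rw [e0]
      rw [h25, e24, hal2] at hx
      generalize extendBundle.sem I s2 = s3 at *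
      have hal3 : alloc I s3 = alloc I s := by
        unfold alloc; rw [hxf 0 (by decide) (by decide), e0]
      have hy := reduce_spec hI s3
      have hyf : ∀ a, a ≠ 3 → a ≠ 4 → a ≠ 5 → a ≠ 21 → a ≠ 22 → a ≠ 23 →
          (reduce.sem I s3).nat a = s3.nat a :=
        fun a h3 h4 h5 h21 h22 h23 => nat_sem_of_not_writes I _ _ (by
          simp [reduce, findEnvier, sumValues, writesNat, h3.symm, h4.symm, h5.symm, h21.symm,
            h22.symm, h23.symm])
      rw [hx, hal3] at hy
      generalize reduce.sem I s3 = s4 at *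
      have hf4 : ∀ a, a ≠ 3 → a ≠ 4 → a ≠ 5 → a ≠ 20 → a ≠ 21 → a ≠ 22 → a ≠ 23 →
          s4.nat a = s2.nat a :=
        fun a h3 h4 h5 h20 h21 h22 h23 => by rw [hyf a h3 h4 h5 h21 h22 h23, hxf a h3 h20]
      -- By `hno` somebody envies the extended bundle, so the reduction does yield a champion and no
      -- subtraction is truncated below.
      have hy' : ∃ c < I.numAgents, s4.nat 5 0 0 = c + 1 ∧
          supp I (s4.nat 3 0) ⊆ insert (s.nat 24 0 0) (alloc I s k) ∧
          Envies I I.eps (alloc I s) c (supp I (s4.nat 3 0)) ∧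
          ∀ h ∈ supp I (s4.nat 3 0), ∀ i < I.numAgents,
            ¬ Envies I I.eps (alloc I s) i ((supp I (s4.nat 3 0)).erase h) := by
        rcases hy with ⟨-, -, hy⟩ | hy
        · obtain ⟨i, hi, hi'⟩ := hno k hk
          exact absurd hi' (hy i hi)
        · exact hy
      clear hy
      obtain ⟨c, hcn, hc5, c1, c2, c3⟩ := hy'
      have h425 : s4.nat 25 0 0 = k := by
        rw [hf4 25 (by decide) (by decide) (by decide) (by decide) (by decide) (by decide)
          (by decide), h25]
      have h40 : s4.nat 0 = s.nat 0 := by rw [hf4 0, e0] <;> decide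
      have h413 : s4.nat 13 = s.nat 13 := by rw [hf4 13, e13] <;> decide
      have h424 : s4.nat 24 = s.nat 24 := by rw [hf4 24, e24] <;> decide
      have h414 : s4.nat 14 = s2.nat 14 := by rw [hf4 14] <;> decide
      have h415 : s4.nat 15 = s2.nat 15 := by rw [hf4 15] <;> decide
      have h416 : s4.nat 16 = s2.nat 16 := by rw [hf4 16] <;> decide
      simp only [sem_setNat, NExp.eval, h425, hc5, Nat.add_sub_cancel]
      set s5 := s4.setNat 14 k 0 c with hs5
      have hn5 : ∀ a, a ≠ 14 → s5.nat a = s4.nat a :=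
        fun a ha => nat_setNat_of_ne _ _ _ _ ha.symm
      have h525 : s5.nat 25 0 0 = k := by rw [hn5 25 (by decide), h425]
      have h514 : s5.nat 14 k 0 = c := by simp [hs5]
      have h514' : ∀ j, j ≠ k → s5.nat 14 j 0 = s2.nat 14 j 0 := fun j hj => by
        simp [hs5, hj, h414]
      clear_value s5
      obtain ⟨hz, hz'⟩ := copyRow_spec I s5 (dst := 15) (di := cell 25) (src := 3)
        (si := .lit 0) k 0
        (by decide) (by decide) (by decide)
        (fun s' h => by simp only [NExp.eval, h 25 (by decide) (by decide), h525])
        (fun _ _ => rfl)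
      have hzf : ∀ a, a ≠ 15 → a ≠ 20 →
          ((copyRow 15 (cell 25) 3 (.lit 0)).sem I s5).nat a = s5.nat a :=
        fun a h3 h20 => nat_sem_of_not_writes I _ _ (by
          simp [copyRow, writesNat, h3.symm, h20.symm])
      generalize (copyRow 15 (cell 25) 3 (.lit 0)).sem I s5 = s6 at *
      have h625 : s6.nat 25 0 0 = k := by rw [hzf 25 (by decide) (by decide), h525]
      have h614 : s6.nat 14 = s5.nat 14 := hzf 14 (by decide) (by decide)
      have h616 : s6.nat 16 = s2.nat 16 := by
        rw [hzf 16 (by decide) (by decide), hn5 16 (by decide), h416]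
      rw [hn5 3 (by decide)] at hz
      simp only [h625, h614, h514, h616]
      set s7 := s6.setNat 16 c 0 (s2.nat 16 c 0 + 1) with hs7
      have hn7 : ∀ a, a ≠ 16 → s7.nat a = s6.nat a :=
        fun a ha => nat_setNat_of_ne _ _ _ _ ha.symm
      rw [hn7 0 (by decide), hn7 13 (by decide), hn7 24 (by decide), hn7 14 (by decide),
        hn7 15 (by decide), h614]
      refine ⟨⟨?_, ?_, ?_⟩, ?_, ?_⟩
      · rw [hzf 0 (by decide) (by decide), hn5 0 (by decide), h40]
      · rw [hzf 13 (by decide) (by decide), hn5 13 (by decide), h413]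
      · rw [hzf 24 (by decide) (by decide), hn5 24 (by decide), h424]
      · intro j hj hju
        rcases Nat.lt_succ_iff_lt_or_eq.1 hj with hj | rfl
        · rw [h514' j hj.ne, hz' j hj.ne, hn5 15 (by decide), h415]
          exact e1 j hj hju
        · rw [h514, hz]
          exact ⟨hcn, c1, c2, c3⟩
      · intro t ht
        have hcongr : (range k).filter (fun j => 0 < s.nat 13 j 0 ∧ s5.nat 14 j 0 = t) =
            (range k).filter (fun j => 0 < s.nat 13 j 0 ∧ s2.nat 14 j 0 = t) :=
          filter_congr fun j hj => by rw [h514' j (mem_range.1 hj).ne]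
        rw [range_add_one, filter_insert, h514, hcongr]
        by_cases hct : c = t
        · subst hct
          rw [if_pos ⟨hp, rfl⟩, card_insert_of_notMem (by simp), ← e2 c ht]
          simp [hs7]
        · rw [if_neg (fun h => hct h.2), ← e2 t ht]
          simp [hs7, Ne.symm hct, h616]
    · simp only [hp, if_false]
      refine ⟨⟨e0, e13, e24⟩, ?_, ?_⟩
      · intro j hj hju
        rcases Nat.lt_succ_iff_lt_or_eq.1 hj with hj | rfl
        · exact e1 j hj hju
        · exact absurd hju hp
      · intro t ht
        rw [range_add_one, filter_insert, if_neg (fun h => hp h.1)]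
        exact e2 t ht
  · rintro s1 ⟨-, e1, e2⟩ rfl
    exact ⟨e1, e2⟩

theorem findBest_spec {I : Input} (hI : I.Valid) (s : Memory) :
    (findBest.sem I s).nat 17 0 0 < I.numAgents ∧
      ∀ t < I.numAgents, s.nat 16 t 0 ≤ s.nat 16 ((findBest.sem I s).nat 17 0 0) 0 := by
  generalize he : findBest.sem I s = s'
  rw [findBest, sem_seq] at he
  refine count_induction he (fun k s' => s'.nat 16 = s.nat 16 ∧ s'.nat 17 0 0 < I.numAgents ∧
    ∀ t < k, s.nat 16 t 0 ≤ s.nat 16 (s'.nat 17 0 0) 0) ?_ ?_ ?_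
  -- The initial candidate 0 is an agent because there is at least one.
  · exact ⟨rfl, by simpa [NExp.eval] using hI.agents_pos, by simp⟩
  · rintro k hk s1 ⟨e0, e1, e2⟩
    have hn2 : ∀ a, a ≠ 25 → (s1.setNat 25 0 0 k).nat a = s1.nat a :=
      fun a ha => nat_setNat_of_ne _ _ _ _ ha.symm
    have h25 : (s1.setNat 25 0 0 k).nat 25 0 0 = k := by simp
    simp only [sem_ite, Test.Holds, NExp.eval, sem_skip, sem_setNat, h25, hn2 16 (by decide),
      hn2 17 (by decide), e0]
    by_cases hp : s.nat 16 (s1.nat 17 0 0) 0 < s.nat 16 k 0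
    · simp only [hp, if_true]
      refine ⟨e0, by simpa using (show k < I.numAgents from hk), fun t ht => ?_⟩
      have h17 : ((s1.setNat 25 0 0 k).setNat 17 0 0 k).nat 17 0 0 = k := by simp
      rw [h17]
      rcases Nat.lt_succ_iff_lt_or_eq.1 ht with ht | rfl
      · exact (e2 t ht).trans hp.le
      · exact le_rfl
    · simp only [hp, if_false]
      refine ⟨e0, e1, fun t ht => ?_⟩
      rcases Nat.lt_succ_iff_lt_or_eq.1 ht with ht | rfl
      · exact e2 t ht
      · exact not_lt.1 hp
  · rintro s1 ⟨-, e1, e2⟩ rfl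
    exact ⟨e1, e2⟩

theorem assignBest_spec (I : Input) (s : Memory) :
    ∀ j < I.numAgents,
      (0 < (assignBest.sem I s).nat 13 j 0 ↔
        0 < s.nat 13 j 0 ∧ s.nat 14 j 0 ≠ s.nat 17 0 0) ∧
      (assignBest.sem I s).nat 11 j 0 =
        (if 0 < s.nat 13 j 0 ∧ s.nat 14 j 0 = s.nat 17 0 0 then s.nat 17 0 0
          else s.nat 11 j 0) ∧
      supp I ((assignBest.sem I s).nat 12 j) =
        if 0 < s.nat 13 j 0 ∧ s.nat 14 j 0 = s.nat 17 0 0 then supp I (s.nat 15 j)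
          else supp I (s.nat 12 j) := by
  generalize he : assignBest.sem I s = s'
  refine count_induction he (fun k s' =>
    (s'.nat 14 = s.nat 14 ∧ s'.nat 15 = s.nat 15 ∧ s'.nat 17 = s.nat 17) ∧
    -- Rows not yet visited are untouched, so the test at `k` refers to the initial memory.
    (∀ j, k ≤ j → s'.nat 13 j = s.nat 13 j ∧ s'.nat 11 j = s.nat 11 j ∧
      s'.nat 12 j = s.nat 12 j) ∧
    ∀ j < k, (0 < s'.nat 13 j 0 ↔ 0 < s.nat 13 j 0 ∧ s.nat 14 j 0 ≠ s.nat 17 0 0) ∧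
      s'.nat 11 j 0 = (if 0 < s.nat 13 j 0 ∧ s.nat 14 j 0 = s.nat 17 0 0 then s.nat 17 0 0
          else s.nat 11 j 0) ∧
      supp I (s'.nat 12 j) =
        if 0 < s.nat 13 j 0 ∧ s.nat 14 j 0 = s.nat 17 0 0 then supp I (s.nat 15 j)
          else supp I (s.nat 12 j)) ?_ ?_ ?_
  · exact ⟨⟨rfl, rfl, rfl⟩, fun _ _ => ⟨rfl, rfl, rfl⟩, by simp⟩
  · rintro k hk s1 ⟨⟨e14, e15, e17⟩, e1, e2⟩
    set s2 := s1.setNat 25 0 0 k with hs2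
    have hn2 : ∀ a, a ≠ 25 → s2.nat a = s1.nat a := fun a ha => nat_setNat_of_ne _ _ _ _ ha.symm
    have h25 : s2.nat 25 0 0 = k := by simp [hs2]
    rw [← hn2 14 (by decide)] at e14
    rw [← hn2 15 (by decide)] at e15
    rw [← hn2 17 (by decide)] at e17
    rw [← hn2 11 (by decide), ← hn2 12 (by decide), ← hn2 13 (by decide)] at e1 e2
    clear_value s2
    obtain ⟨k13, k11, k12⟩ := e1 k le_rfl
    have hcond : (0 < s.nat 13 k 0 ∧ ¬ s.nat 14 k 0 < s.nat 17 0 0 ∧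
        ¬ s.nat 17 0 0 < s.nat 14 k 0) ↔ 0 < s.nat 13 k 0 ∧ s.nat 14 k 0 = s.nat 17 0 0 := by
      refine and_congr_right fun _ => ?_
      omega
    simp only [sem_ite, Test.Holds, NExp.eval, sem_skip, h25, e14, e17, k13, hcond]
    by_cases hp : 0 < s.nat 13 k 0 ∧ s.nat 14 k 0 = s.nat 17 0 0
    · simp only [hp, and_self, if_true, sem_seq, sem_setNat, NExp.eval, h25]
      have h25' : (s2.setNat 13 k 0 0).nat 25 0 0 = k := by simp [h25]
      have h17' : (s2.setNat 13 k 0 0).nat 17 0 0 = s.nat 17 0 0 := by simp [e17]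
      simp only [h25', h17']
      set s3 := (s2.setNat 13 k 0 0).setNat 11 k 0 (s.nat 17 0 0) with hs3
      have hn3 : ∀ a, a ≠ 11 → a ≠ 13 → s3.nat a = s2.nat a := fun a h1 h2 => by
        rw [hs3, nat_setNat_of_ne _ _ _ _ h1.symm, nat_setNat_of_ne _ _ _ _ h2.symm]
      have h313 : ∀ j, s3.nat 13 j 0 = if j = k then 0 else s2.nat 13 j 0 := fun j => by
        simp [hs3]
      have h311 : ∀ j, s3.nat 11 j 0 = if j = k then s.nat 17 0 0 else s2.nat 11 j 0 :=
        fun j => by simp [hs3]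
      have h313' : ∀ j, j ≠ k → s3.nat 13 j = s2.nat 13 j := fun j hj => by
        funext x; simp [hs3, hj]
      have h311' : ∀ j, j ≠ k → s3.nat 11 j = s2.nat 11 j := fun j hj => by
        funext x; simp [hs3, hj]
      have h325 : s3.nat 25 0 0 = k := by rw [hn3 25 (by decide) (by decide), h25]
      clear_value s3
      obtain ⟨hz, hz'⟩ := copyRow_spec I s3 (dst := 12) (di := cell 25) (src := 15)
        (si := cell 25) k k (by decide) (by decide) (by decide)
        (fun s' h => by simp only [NExp.eval, h 25 (by decide) (by decide), h325])
        (fun s' h => by simp only [NExp.eval, h 25 (by decide) (by decide), h325])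
      have hzf : ∀ a, a ≠ 12 → a ≠ 20 →
          ((copyRow 12 (cell 25) 15 (cell 25)).sem I s3).nat a = s3.nat a :=
        fun a h3 h20 => nat_sem_of_not_writes I _ _ (by
          simp [copyRow, writesNat, h3.symm, h20.symm])
      generalize (copyRow 12 (cell 25) 15 (cell 25)).sem I s3 = s4 at *
      rw [hzf 14 (by decide) (by decide), hzf 15 (by decide) (by decide),
        hzf 17 (by decide) (by decide), hzf 13 (by decide) (by decide),
        hzf 11 (by decide) (by decide), hn3 14 (by decide) (by decide),
        hn3 15 (by decide) (by decide), hn3 17 (by decide) (by decide)]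
      refine ⟨⟨e14, e15, e17⟩, fun j hj => ?_, fun j hj => ?_⟩
      · have hne : j ≠ k := by omega
        rw [h313' j hne, h311' j hne, hz' j hne, hn3 12 (by decide) (by decide)]
        exact e1 j (by omega)
      · rcases Nat.lt_succ_iff_lt_or_eq.1 hj with hj | rfl
        · rw [h313' j hj.ne, h311' j hj.ne, hz' j hj.ne, hn3 12 (by decide) (by decide)]
          exact e2 j hj
        · rw [hz, hn3 15 (by decide) (by decide), e15, h313, h311]
          simp [hp]
    · simp only [hp, if_false]
      refine ⟨⟨e14, e15, e17⟩, fun j hj => e1 j (by omega), fun j hj => ?_⟩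
      rcases Nat.lt_succ_iff_lt_or_eq.1 hj with hj | rfl
      · exact e2 j hj
      · simp only [hp, if_false, k13, k11, k12, and_true]
        tauto
  · rintro s1 ⟨-, -, e2⟩ rfl
    exact e2

/-- The set `U` of the greedy choice. -/
def takerless (I : Input) (s : Memory) : Finset ℕ :=
  (range I.numAgents).filter fun j => 0 < s.nat 13 j 0

/-- The invariant is `Greedy` itself: a pool good is one `Greedy.step`, any other good a
`Greedy.skip`. -/
theorem greedy_spec {I : Input} (hI : I.Valid) (s : Memory) (hX : Fair I (alloc I s))
    (hpool : supp I (s.nat 1 0) = I.pool (alloc I s))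
    (hno : ∀ g ∈ I.pool (alloc I s), ∀ j < I.numAgents, ∃ i < I.numAgents,
      Envies I I.eps (alloc I s) i (insert g (alloc I s j))) :
    Greedy I (alloc I s) I.numGoods (takerless I (greedy.sem I s))
      (fun j => (greedy.sem I s).nat 11 j 0) (fun j => supp I ((greedy.sem I s).nat 12 j)) := by
  generalize he : greedy.sem I s = s'
  rw [greedy, sem_seq] at he
  refine count_induction he (fun k s' => s'.nat 0 = s.nat 0 ∧ s'.nat 1 = s.nat 1 ∧
    Greedy I (alloc I s) k (takerless I s') (fun j => s'.nat 11 j 0)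
      (fun j => supp I (s'.nat 12 j))) ?_ ?_ ?_
  · have h := initGreedy_spec I s
    have hf : ∀ a, a = 0 ∨ a = 1 → (initGreedy.sem I s).nat a = s.nat a := by
      rintro a (rfl | rfl) <;> exact nat_sem_of_not_writes I _ _ rfl
    generalize initGreedy.sem I s = s1 at *
    refine ⟨hf 0 (Or.inl rfl), hf 1 (Or.inr rfl),
      Greedy.init hX (filter_subset _ _) ?_ ?_ ?_ fun j hj => (h j hj).2⟩
    · intro j hj
      obtain ⟨hj, hj'⟩ := mem_filter.1 hj
      rcases (h j (mem_range.1 hj)).1 with h' | h'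
      · omega
      · exact h'.2
    all_goals
      intro j hj hjU
      have hjU' : ¬ 0 < s1.nat 13 j 0 := fun h' => hjU (mem_filter.2 ⟨mem_range.2 hj, h'⟩)
      rcases (h j hj).1 with h' | h'
      · first | exact h'.2.1 | exact h'.2.2
      · exact absurd h'.1 hjU'
  · rintro k hk s1 ⟨e0, e1, e2⟩
    set s2 := s1.setNat 24 0 0 k with hs2
    have hn2 : ∀ a, a ≠ 24 → s2.nat a = s1.nat a := fun a ha => nat_setNat_of_ne _ _ _ _ ha.symm
    have h24 : s2.nat 24 0 0 = k := by simp [hs2]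
    have hU2 : takerless I s1 = takerless I s2 := by
      unfold takerless; rw [hn2 13 (by decide)]
    rw [← hn2 0 (by decide)] at e0
    rw [← hn2 1 (by decide)] at e1
    rw [← hn2 11 (by decide), ← hn2 12 (by decide), hU2] at e2
    clear_value s2
    simp only [sem_ite, Test.Holds, NExp.eval, sem_skip, h24, e1]
    have hkm : k ∈ I.pool (alloc I s) ↔ 0 < s.nat 1 0 k := by
      rw [← hpool, mem_supp]
      exact and_iff_right hk
    by_cases hp : 0 < s.nat 1 0 k
    · simp only [hp, if_true, sem_seq]
      rw [← hkm] at hp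
      have hx := clearCounts_spec I s2
      have hxf : ∀ a, a ≠ 16 → a ≠ 25 → (clearCounts.sem I s2).nat a = s2.nat a :=
        fun a h3 h20 => nat_sem_of_not_writes I _ _ (by
          simp [clearCounts, writesNat, h3.symm, h20.symm])
      generalize clearCounts.sem I s2 = s3 at *
      have hal3 : alloc I s3 = alloc I s := by
        unfold alloc; rw [hxf 0 (by decide) (by decide), e0]
      have h324 : s3.nat 24 0 0 = k := by rw [hxf 24 (by decide) (by decide), h24]
      obtain ⟨hy, hy'⟩ := findChampions_spec hI s3 (by rw [h324]; exact hk)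
        (by rw [h324, hal3]; exact hno k hp) hx
      have hyf : ∀ a, a = 0 ∨ a = 1 ∨ a = 11 ∨ a = 12 ∨ a = 13 →
          (findChampions.sem I s3).nat a = s3.nat a := by
        rintro a (rfl | rfl | rfl | rfl | rfl) <;> exact nat_sem_of_not_writes I _ _ rfl
      rw [h324, hal3, hxf 13 (by decide) (by decide)] at hy
      rw [hxf 13 (by decide) (by decide)] at hy'
      generalize findChampions.sem I s3 = s4 at *
      have hf4 : ∀ a, a = 0 ∨ a = 1 ∨ a = 11 ∨ a = 12 ∨ a = 13 → s4.nat a = s2.nat a :=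
        fun a ha => by rw [hyf a ha, hxf a (by omega) (by omega)]
      obtain ⟨hz, hz'⟩ := findBest_spec hI s4
      have hzf : ∀ a, a ≠ 17 → a ≠ 25 → (findBest.sem I s4).nat a = s4.nat a :=
        fun a h3 h20 => nat_sem_of_not_writes I _ _ (by
          simp [findBest, writesNat, h3.symm, h20.symm])
      generalize findBest.sem I s4 = s5 at *
      have hf5 : ∀ a, a = 0 ∨ a = 1 ∨ a = 11 ∨ a = 12 ∨ a = 13 → s5.nat a = s2.nat a :=
        fun a ha => by rw [hzf a (by omega) (by omega), hf4 a ha]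
      have hw := assignBest_spec I s5
      have hwf : ∀ a, a = 0 ∨ a = 1 → (assignBest.sem I s5).nat a = s5.nat a := by
        rintro a (rfl | rfl) <;> exact nat_sem_of_not_writes I _ _ rfl
      rw [hf5 13 (by decide), hf5 11 (by decide), hf5 12 (by decide),
        hzf 14 (by decide) (by decide), hzf 15 (by decide) (by decide)] at hw
      generalize assignBest.sem I s5 = s6 at *
      have hU : ∀ j, j ∈ takerless I s2 ↔ j < I.numAgents ∧ 0 < s2.nat 13 j 0 := by
        simp [takerless]
      refine ⟨by rw [hwf 0 (Or.inl rfl), hf5 0 (by decide), e0],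
        by rw [hwf 1 (Or.inr rfl), hf5 1 (by decide), e1],
        Greedy.step hI hX e2 hp (K := fun j => s4.nat 14 j 0) (D := fun j => supp I (s4.nat 15 j))
          (t := s5.nat 17 0 0) ?_ ?_ ?_ ?_ ?_ ?_ ?_ ?_⟩
      · exact fun j hj => (hy j ((hU j).1 hj).1 ((hU j).1 hj).2).1
      · exact fun j hj => (hy j ((hU j).1 hj).1 ((hU j).1 hj).2).2.2.1
      · exact fun j hj => (hy j ((hU j).1 hj).1 ((hU j).1 hj).2).2.1
      · exact fun j hj => (hy j ((hU j).1 hj).1 ((hU j).1 hj).2).2.2.2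
      · intro t' ht'
        have h1 := hz' t' ht'
        rw [hy' t' ht', hy' _ hz] at h1
        simpa only [takerless, filter_filter] using h1
      · ext j
        rw [mem_filter, hU]
        simp only [takerless, mem_filter, mem_range, and_assoc]
        exact and_congr_right fun hj => (hw j hj).1
      · intro j hj
        simp only [(hw j hj).2.1, hU, hj, true_and]
      · intro j hj
        simp only [(hw j hj).2.2, hU, hj, true_and]
    · simp only [hp, if_false]
      exact ⟨e0, e1, e2.skip fun h => hp (hkm.1 h)⟩
  · rintro s1 ⟨-, -, e2⟩ rfl
    exact e2

theorem checkTotal_spec (I : Input) (s : Memory) :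
    0 < (checkTotal.sem I s).nat 19 0 0 ↔ (takerless I s).Nonempty := by
  generalize he : checkTotal.sem I s = s'
  rw [checkTotal, sem_seq] at he
  refine count_induction he (fun k s' => s'.nat 13 = s.nat 13 ∧
    (0 < s'.nat 19 0 0 ↔ ∃ j < k, 0 < s.nat 13 j 0)) ?_ ?_ ?_
  · exact ⟨rfl, by simp [NExp.eval]⟩
  · rintro k hk s1 ⟨e0, e1⟩
    have hn2 : ∀ a, a ≠ 25 → (s1.setNat 25 0 0 k).nat a = s1.nat a :=
      fun a ha => nat_setNat_of_ne _ _ _ _ ha.symm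
    have h25 : (s1.setNat 25 0 0 k).nat 25 0 0 = k := by simp
    simp only [sem_ite, Test.Holds, NExp.eval, sem_skip, sem_setNat, h25, hn2 13 (by decide), e0]
    by_cases hp : 0 < s.nat 13 k 0
    · simp only [hp, if_true]
      refine ⟨e0, ?_⟩
      simp only [nat_setNat, and_self, if_true, zero_lt_one, true_iff]
      exact ⟨k, by omega, hp⟩
    · simp only [hp, if_false]
      refine ⟨e0, ?_⟩
      rw [hn2 19 (by decide), e1]
      refine ⟨fun ⟨j, hj, h⟩ => ⟨j, by omega, h⟩, fun ⟨j, hj, h⟩ => ⟨j, ?_, h⟩⟩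
      have : j ≠ k := fun he => hp (he ▸ h)
      omega
  · rintro s1 ⟨-, e1⟩ rfl
    rw [nat_setNat_of_ne _ _ _ _ (by decide), e1]
    simp [takerless, Finset.Nonempty, Dim.size]

/-! ### Rotation along a cycle of takers -/

theorem findCycle_spec (I : Input) (s : Memory) :
    (findCycle.sem I s).nat 18 0 0 = (fun j => s.nat 11 j 0)^[I.numAgents] 0 := by
  generalize he : findCycle.sem I s = s'
  rw [findCycle, sem_seq] at he
  refine count_induction he (fun k s' => s'.nat 11 = s.nat 11 ∧
    s'.nat 18 0 0 = (fun j => s.nat 11 j 0)^[k] 0) ?_ ?_ ?_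
  · exact ⟨rfl, by simp [NExp.eval]⟩
  · rintro k hk s1 ⟨e0, e1⟩
    rw [Function.iterate_succ_apply']
    simp [NExp.eval, e0, e1, nat_setNat_of_ne]
  · rintro s1 ⟨-, e1⟩ rfl
    exact e1

/-- The `n ≥ p` passes cover the cycle, perhaps repeatedly. Repetition is harmless: the new bundles
are read from array 12, which is not modified, and φ is injective on periodic points, so a recipient
always gets the same bundle. -/
theorem rotateCycle_spec {I : Input} (s : Memory) {φ : ℕ → ℕ} {y : ℕ}
    (hφ : ∀ j, φ j = s.nat 11 j 0) (hy : y = s.nat 18 0 0) {p : ℕ} (hp : 0 < p)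
    (hpn : p ≤ I.numAgents) (hper : Function.IsPeriodicPt φ p y) :
    (∀ a, alloc I (rotateCycle.sem I s) (φ (φ^[a] y)) = supp I (s.nat 12 (φ^[a] y))) ∧
      ∀ k, (∀ a, k ≠ φ (φ^[a] y)) → alloc I (rotateCycle.sem I s) k = alloc I s k := by
  have hmem : ∀ a, φ^[a] y ∈ Function.periodicPts φ :=
    fun a => ⟨p, hp, hper.apply_iterate a⟩
  have hinj : ∀ a b, φ (φ^[a] y) = φ (φ^[b] y) → φ^[a] y = φ^[b] y := fun a b h =>
    (Function.bijOn_periodicPts φ).injOn (hmem a) (hmem b) h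
  have hsmall : ∀ a, ∃ b < I.numAgents, φ^[a] y = φ^[b] y := fun a =>
    ⟨a % p, (Nat.mod_lt _ hp).trans_le hpn, (hper.iterate_mod_apply a).symm⟩
  generalize he : rotateCycle.sem I s = s'
  refine count_induction he (fun k s' => (s'.nat 11 = s.nat 11 ∧ s'.nat 12 = s.nat 12) ∧
    s'.nat 18 0 0 = φ^[k] y ∧
    (∀ a < k, alloc I s' (φ (φ^[a] y)) = supp I (s.nat 12 (φ^[a] y))) ∧
    ∀ j, (∀ a < k, j ≠ φ (φ^[a] y)) → alloc I s' j = alloc I s j) ?_ ?_ ?_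
  · exact ⟨⟨rfl, rfl⟩, hy.symm, by simp, fun _ _ => rfl⟩
  · rintro k hk s1 ⟨⟨e11, e12⟩, e18, e1, e2⟩
    set s2 := s1.setNat 24 0 0 k with hs2
    have hn2 : ∀ a, a ≠ 24 → s2.nat a = s1.nat a := fun a ha => nat_setNat_of_ne _ _ _ _ ha.symm
    have hal2 : alloc I s1 = alloc I s2 := by unfold alloc; rw [hn2 0 (by decide)]
    rw [← hn2 11 (by decide)] at e11
    rw [← hn2 12 (by decide)] at e12
    rw [← hn2 18 (by decide)] at e18
    rw [hal2] at e1 e2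
    clear_value s2
    rw [sem_seq]
    obtain ⟨hz, hz'⟩ := copyRow_spec I s2 (dst := 0) (di := .read 11 (cell 18) (.lit 0)) (src := 12)
      (si := cell 18) (φ (φ^[k] y)) (φ^[k] y) (by decide) (by decide) (by decide)
      (fun s' h => by
        simp only [NExp.eval, h 18 (by decide) (by decide), h 11 (by decide) (by decide), e18, e11,
          hφ])
      (fun s' h => by simp only [NExp.eval, h 18 (by decide) (by decide), e18])
    have hzf : ∀ a, a ≠ 0 → a ≠ 20 →
        ((copyRow 0 (.read 11 (cell 18) (.lit 0)) 12 (cell 18)).sem I s2).nat a = s2.nat a :=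
      fun a h3 h20 => nat_sem_of_not_writes I _ _ (by
        simp [copyRow, writesNat, h3.symm, h20.symm])
    generalize (copyRow 0 (.read 11 (cell 18) (.lit 0)) 12 (cell 18)).sem I s2 = s3 at *
    rw [e12] at hz
    simp only [sem_setNat, NExp.eval, hzf 18 (by decide) (by decide), e18,
      hzf 11 (by decide) (by decide), e11, ← hφ]
    set s4 := s3.setNat 18 0 0 (φ (φ^[k] y)) with hs4
    have hn4 : ∀ a, a ≠ 18 → s4.nat a = s3.nat a := fun a ha => nat_setNat_of_ne _ _ _ _ ha.symm
    have hal4 : ∀ j, alloc I s4 j = supp I (s3.nat 0 j) := fun j => by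
      unfold alloc; rw [hn4 0 (by decide)]
    have hal4' : ∀ j, j ≠ φ (φ^[k] y) → alloc I s4 j = alloc I s2 j := fun j hj => by
      rw [hal4, hz' j hj]; rfl
    refine ⟨⟨?_, ?_⟩, ?_, ?_, ?_⟩
    · rw [hn4 11 (by decide), hzf 11 (by decide) (by decide), e11]
    · rw [hn4 12 (by decide), hzf 12 (by decide) (by decide), e12]
    · rw [Function.iterate_succ_apply']; simp [hs4]
    · intro a ha
      by_cases hak : φ (φ^[a] y) = φ (φ^[k] y)
      · rw [hak, hal4, hz, hinj a k hak]
      · rw [hal4' _ hak]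
        refine e1 a ?_
        have : a ≠ k := fun h => hak (by rw [h])
        omega
    · intro j hj
      rw [hal4' j (hj k (by omega))]
      exact e2 j fun a ha => hj a (by omega)
  · rintro s1 ⟨-, -, e1, e2⟩ rfl
    have hal : alloc I (s1.setNat 24 0 0 (Dim.agents.size I)) = alloc I s1 := by
      unfold alloc; rw [nat_setNat_of_ne _ _ _ _ (by decide)]
    rw [hal]
    refine ⟨fun a => ?_, fun k hk => e2 k fun a _ => hk a⟩
    obtain ⟨b, hb, hab⟩ := hsmall a
    rw [hab]
    exact e1 b hb

/-! ### The effect of one round -/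

/-- The allocation is final. -/
structure Final (I : Input) (s : Memory) : Prop where
  fair : Fair I (alloc I s)
  pool : supp I (s.nat 1 0) = I.pool (alloc I s)
  card_le : ((I.pool (alloc I s)).card : ℝ) ≤ 64 * ((I.numAgents : ℝ) / I.eps) ^ ((4 : ℝ) / 5)

theorem round_spec {I : Input} (hI : I.Valid) (s : Memory) (hX : Fair I (alloc I s))
    (hd : s.nat 2 0 0 = 0) :
    ((round.sem I s).nat 2 0 0 = 0 ∧ Fair I (alloc I (round.sem I s)) ∧
      Progress I (alloc I s) (alloc I (round.sem I s))) ∨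
    ((round.sem I s).nat 2 0 0 = 1 ∧ Final I (round.sem I s)) := by
  rw [round]
  simp only [sem_seq]
  have hp := computePool_spec I s
  have hf1 : ∀ a, a = 0 ∨ a = 2 → (computePool.sem I s).nat a = s.nat a := by
    rintro a (rfl | rfl) <;> exact nat_sem_of_not_writes I _ _ rfl
  generalize computePool.sem I s = s1 at *
  have hal1 : alloc I s1 = alloc I s := by unfold alloc; rw [hf1 0 (by decide)]
  have hr := reducePool_spec hI s1
  have hf2 : ∀ a, a = 0 ∨ a = 1 ∨ a = 2 → (reducePool.sem I s1).nat a = s1.nat a := by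
    rintro a (rfl | rfl | rfl) <;> exact nat_sem_of_not_writes I _ _ rfl
  rw [hp, hal1] at hr
  generalize reducePool.sem I s1 = s2 at *
  have hal2 : alloc I s2 = alloc I s := by unfold alloc; rw [hf2 0 (by decide), hf1 0 (by decide)]
  have ha := findAddable_spec I s2
  have hf3 : ∀ a, a = 0 ∨ a = 1 ∨ a = 2 ∨ a = 6 ∨ a = 7 →
      (findAddable.sem I s2).nat a = s2.nat a := by
    rintro a (rfl | rfl | rfl | rfl | rfl) <;> exact nat_sem_of_not_writes I _ _ rfl
  rw [hf2 1 (by decide), hp, hal2] at ha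
  rw [← hf3 6 (by decide), ← hf3 7 (by decide)] at hr
  generalize findAddable.sem I s2 = s3 at *
  have hal3 : alloc I s3 = alloc I s := by
    unfold alloc; rw [hf3 0 (by decide), hf2 0 (by decide), hf1 0 (by decide)]
  have hp3 : supp I (s3.nat 1 0) = I.pool (alloc I s) := by
    rw [hf3 1 (by decide), hf2 1 (by decide), hp]
  have hg := greedy_spec hI s3 (by rwa [hal3]) (by rw [hal3, hp3])
  have hf4 : ∀ a, a = 0 ∨ a = 1 ∨ a = 2 ∨ a = 6 ∨ a = 7 ∨ a = 8 ∨ a = 9 ∨ a = 10 →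
      (greedy.sem I s3).nat a = s3.nat a := by
    rintro a (rfl | rfl | rfl | rfl | rfl | rfl | rfl | rfl) <;>
      exact nat_sem_of_not_writes I _ _ rfl
  rw [hal3] at hg
  rw [← hf4 6 (by decide), ← hf4 7 (by decide)] at hr
  rw [← hf4 8 (by decide), ← hf4 9 (by decide), ← hf4 10 (by decide)] at ha
  generalize greedy.sem I s3 = s4 at *
  have hc := checkTotal_spec I s4
  have hf5 : ∀ a, a ≠ 19 → a ≠ 25 → (checkTotal.sem I s4).nat a = s4.nat a :=
    fun a h3 h20 => nat_sem_of_not_writes I _ _ (by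
      simp [checkTotal, writesNat, h3.symm, h20.symm])
  have hU : takerless I (checkTotal.sem I s4) = takerless I s4 := by
    unfold takerless; rw [hf5 13 (by decide) (by decide)]
  rw [← hU] at hc hg
  rw [← hf5 11 (by decide) (by decide), ← hf5 12 (by decide) (by decide)] at hg
  rw [← hf5 6 (by decide) (by decide), ← hf5 7 (by decide) (by decide)] at hr
  rw [← hf5 8 (by decide) (by decide), ← hf5 9 (by decide) (by decide),
    ← hf5 10 (by decide) (by decide)] at ha
  generalize checkTotal.sem I s4 = s5 at *
  have h50 : s5.nat 0 = s.nat 0 := by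
    rw [hf5 0 (by decide) (by decide), hf4 0 (by decide), hf3 0 (by decide), hf2 0 (by decide),
      hf1 0 (by decide)]
  have h51 : supp I (s5.nat 1 0) = I.pool (alloc I s) := by
    rw [hf5 1 (by decide) (by decide), hf4 1 (by decide), hp3]
  have h52 : s5.nat 2 0 0 = 0 := by
    rw [hf5 2 (by decide) (by decide), hf4 2 (by decide), hf3 2 (by decide), hf2 2 (by decide),
      hf1 2 (by decide), hd]
  have hal5 : alloc I s5 = alloc I s := by unfold alloc; rw [h50]
  clear hf1 hf2 hf3 hf4 hf5
  rw [improve]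
  simp only [sem_ite, Test.Holds, NExp.eval]
  by_cases h6 : 0 < s5.nat 6 0 0
  · left
    simp only [h6, if_true]
    rcases hr with ⟨hr, -⟩ | ⟨c, hcn, hr1, hr2, hr3, hr4⟩
    · omega
    obtain ⟨hz, hz'⟩ := copyRow_spec I s5 (dst := 0) (di := .sub (cell 6) (.lit 1)) (src := 7)
      (si := .lit 0) c 0 (by decide) (by decide) (by decide)
      (fun s' h => by
        simp only [NExp.eval, h 6 (by decide) (by decide), hr1, Nat.add_sub_cancel])
      (fun _ _ => rfl)
    have h2 : ((copyRow 0 (.sub (cell 6) (.lit 1)) 7 (.lit 0)).sem I s5).nat 2 = s5.nat 2 :=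
      nat_sem_of_not_writes I _ _ rfl
    refine ⟨by rw [h2, h52], hX.swap hI hcn hr2 hr3 hr4 hz fun i hi => ?_⟩
    unfold alloc
    rw [hz' i hi, h50]
  have hr' : ∀ i < I.numAgents, ¬ Envies I I.eps (alloc I s) i (I.pool (alloc I s)) := by
    rcases hr with ⟨-, hr⟩ | ⟨c, -, hr, -⟩
    · exact hr
    · omega
  simp only [h6, if_false]
  by_cases h8 : 0 < s5.nat 8 0 0
  · left
    simp only [h8, if_true, sem_setNat, NExp.eval]
    rcases ha with ⟨ha, -⟩ | ⟨-, ha1, ha2, ha3⟩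
    · omega
    refine ⟨by simp [h52], hX.add hI ha1 ha2 ha3 ?_ fun i hi => ?_⟩
    · unfold alloc
      rw [supp_setNat_one I s5 (mem_pool.1 ha2).1, h50]
    · unfold alloc
      congr 1
      funext g
      simp [hi, h50]
  have hG := hg (by
    rcases ha with ⟨-, ha⟩ | ⟨ha, -⟩
    · exact ha
    · omega)
  simp only [h8, if_false]
  by_cases h19 : 0 < s5.nat 19 0 0
  · right
    simp only [h19, if_true, sem_setNat, NExp.eval]
    have hal6 : alloc I (s5.setNat 2 0 0 1) = alloc I s := hal5
    refine ⟨by simp, ⟨by rwa [hal6], ?_, ?_⟩⟩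
    -- The final round leaves the allocation unchanged, so the pool computed at its beginning is
    -- still correct.
    · rw [hal6, ← h51, nat_setNat_of_ne _ _ _ _ (by decide)]
    · rw [hal6]
      exact hG.card_pool_le hI hr' (hc.1 h19)
  · left
    simp only [h19, if_false, sem_seq]
    have hU0 : takerless I s5 = ∅ := not_nonempty_iff_eq_empty.1 fun h => h19 (hc.2 h)
    rw [hU0] at hG
    have hy := findCycle_spec I s5
    have hyf : ∀ a, a ≠ 18 → a ≠ 24 → (findCycle.sem I s5).nat a = s5.nat a :=
      fun a h3 h20 => nat_sem_of_not_writes I _ _ (by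
        simp [findCycle, writesNat, h3.symm, h20.symm])
    have hlt : ∀ j < I.numAgents, s5.nat 11 j 0 < I.numAgents := fun j hj =>
      hG.lt j hj (notMem_empty j)
    obtain ⟨p, hp0, hpn, hper⟩ := exists_isPeriodicPt_iterate hlt hI.agents_pos
    generalize findCycle.sem I s5 = s6 at *
    rw [← hy] at hper
    obtain ⟨hz, hz'⟩ := rotateCycle_spec (I := I) s6 (φ := fun j => s5.nat 11 j 0)
      (fun j => by rw [hyf 11 (by decide) (by decide)]) rfl hp0 hpn hper
    have hal6 : alloc I s6 = alloc I s := by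
      unfold alloc; rw [hyf 0 (by decide) (by decide), h50]
    rw [hyf 12 (by decide) (by decide)] at hz
    rw [hal6] at hz'
    refine ⟨?_, hG.rotate hI hX ?_ ⟨p, hp0, hper⟩ hz hz'⟩
    · rw [nat_sem_of_not_writes I _ _ (by rfl), hyf 2 (by decide) (by decide), h52]
    · rw [hy]
      exact iterate_lt hlt hI.agents_pos _

end SProg

/-! ### Termination of the whole program -/

open SProg

/-- The algorithm: improve the allocation as long as possible. -/
def algorithm : Prog := .loop (.ltNat (cell 2) (.lit 1)) SProg.round.compile

/-- Induction on an integer bound `r` of the potential: every round that is not final lowers the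
potential by at least one, and it is never negative. -/
theorem exec_algorithm {I : Input} (hI : I.Valid) {W : ℝ} (hW : 1 ≤ W)
    (hWv : ∀ i < I.numAgents, ∀ g < I.numGoods, 0 < I.value i g →
      I.val i (range I.numGoods) ≤ W * I.value i g) {N : ℕ}
    (hn : I.numAgents ≤ N) (hm : I.numGoods ≤ N) (r : ℕ) :
    ∀ s : Memory, Fair I (alloc I s) → s.nat 2 0 0 = 0 → potential I W (alloc I s) ≤ r →
      ∃ t s', Exec I algorithm s t s' ∧ t ≤ (r + 1) * (SProg.round.cost N + 5) + 5 ∧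
        Final I s' := by
  have hlt : ∀ s : Memory, (Test.ltNat (cell 2) (.lit 1)).Holds I s ↔ s.nat 2 0 0 < 1 := by
    intro s; simp [Test.Holds, NExp.eval]
  have hcost : (Test.ltNat (cell 2) (.lit 1)).cost = 5 := rfl
  induction r with
  | zero =>
    intro s hX hd hr
    obtain ⟨t, ht, hle⟩ := exec_compile I N hn hm SProg.round wf_round s
    rcases round_spec hI s hX hd with ⟨-, h2, h3⟩ | ⟨h1, h2⟩
    · have := h3.potential_add_one_le hI hW hWv h2
      have := potential_nonneg hI hW h2
      rw [Nat.cast_zero] at hr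
      linarith
    · refine ⟨_, _, Exec.loop_step ((hlt s).2 (by omega)) ht
        (Exec.loop_stop (by rw [hlt, h1]; omega)), ?_, h2⟩
      rw [hcost]; omega
  | succ r ih =>
    intro s hX hd hr
    obtain ⟨t, ht, hle⟩ := exec_compile I N hn hm SProg.round wf_round s
    rcases round_spec hI s hX hd with ⟨h1, h2, h3⟩ | ⟨h1, h2⟩
    · have hp := h3.potential_add_one_le hI hW hWv h2
      push_cast at hr
      obtain ⟨t', s', he, hle', hfin⟩ := ih _ h2 h1 (by linarith)
      refine ⟨_, s', Exec.loop_step ((hlt s).2 (by omega)) ht he, ?_, hfin⟩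
      rw [hcost, Nat.succ_mul]
      omega
    · refine ⟨_, _, Exec.loop_step ((hlt s).2 (by omega)) ht
        (Exec.loop_stop (by rw [hlt, h1]; omega)), ?_, h2⟩
      rw [hcost, Nat.succ_mul]; omega

/-! ### Transfer between finite index types and natural numbers -/

section Instance

variable {n m : ℕ} {v : Fin n → Finset (Fin m) → ℝ} {ε : ℝ}

theorem instanceInput_value {i g : ℕ} (hi : i < n) (hg : g < m) :
    (instanceInput v ε).value i g = v ⟨i, hi⟩ {⟨g, hg⟩} := dif_pos ⟨hi, hg⟩

theorem instanceInput_valid (hn : 0 < n) (hv : ∀ i, IsAdditiveValuation (v i)) (h0 : 0 < ε)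
    (h1 : ε ≤ 1 / 2) : (instanceInput v ε).Valid where
  value_nonneg i g := by
    unfold instanceInput
    dsimp only
    split_ifs with h
    · exact (hv _).1 _
    · exact le_rfl
  eps_pos := h0
  eps_le := h1
  agents_pos := hn

theorem val_map (hv : ∀ i, IsAdditiveValuation (v i)) (i : Fin n) (S : Finset (Fin m)) :
    (instanceInput v ε).val i (S.map Fin.valEmbedding) = v i S := by
  rw [(hv i).2 S, Input.val, sum_map]
  exact sum_congr rfl fun g _ => instanceInput_value i.2 g.2

theorem map_outputBundles (s : Memory) (i : Fin n) :
    (outputBundles n m s i).map Fin.valEmbedding = alloc (instanceInput v ε) s i := by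
  ext g
  simp only [outputBundles, mem_map, mem_filter, mem_univ, true_and, Fin.valEmbedding_apply, alloc,
    mem_supp, pos_iff_ne_zero]
  exact ⟨fun ⟨a, ha, hag⟩ => hag ▸ ⟨a.2, ha⟩, fun ⟨h, h'⟩ => ⟨⟨g, h⟩, h', rfl⟩⟩

theorem map_outputPool (s : Memory) :
    (outputPool m s).map Fin.valEmbedding = supp (instanceInput v ε) (s.nat 1 0) := by
  ext g
  simp only [outputPool, mem_map, mem_filter, mem_univ, true_and, Fin.valEmbedding_apply,
    mem_supp, pos_iff_ne_zero]
  exact ⟨fun ⟨a, ha, hag⟩ => hag ▸ ⟨a.2, ha⟩, fun ⟨h, h'⟩ => ⟨⟨g, h⟩, h', rfl⟩⟩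

theorem map_unallocated (s : Memory) :
    (unallocated (outputBundles n m s)).map Fin.valEmbedding =
      (instanceInput v ε).pool (alloc (instanceInput v ε) s) := by
  ext g
  rw [mem_pool]
  simp only [unallocated, mem_map, mem_sdiff, mem_univ, true_and, mem_biUnion, not_exists,
    Fin.valEmbedding_apply]
  have hmem : ∀ (a : Fin m) (i : Fin n), a ∈ outputBundles n m s i ↔
      (a : ℕ) ∈ alloc (instanceInput v ε) s i := fun a i => by
    rw [← map_outputBundles]
    exact (mem_map' Fin.valEmbedding).symm
  constructor
  · rintro ⟨a, ha, rfl⟩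
    exact ⟨a.2, fun i hi h => ha ⟨i, hi⟩ ((hmem a ⟨i, hi⟩).2 h)⟩
  · rintro ⟨hg, h⟩
    exact ⟨⟨g, hg⟩, fun i hi => h i i.2 ((hmem ⟨g, hg⟩ i).1 hi), rfl⟩

end Instance

/-- With L = n + m + l + e one has Φ ≤ 4L⁴, hence r + 1 ≤ 6L⁴, and a round with its test costs at
most (C + 5)L^k. This gives 6(C + 5) + 5 = 6C + 35. The bound `he` on `e = 1 / ε` makes `m + 1` and
`n + m + 1` at most L. -/
theorem steps_le {C k : ℕ} {n m t r c : ℕ} {l e Φ : ℝ} (hn : 1 ≤ n) (hl : 0 ≤ l) (he : 2 ≤ e)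
    (hΦ : Φ ≤ n * ((m + 1) * (1 + 2 * l * e)) + m) (hr : (r : ℝ) ≤ Φ + 1)
    (hc : c ≤ C * (n + m + 1) ^ k) (ht : t ≤ (r + 1) * (c + 5) + 5) :
    (t : ℝ) ≤ ((6 * C + 35 : ℕ) : ℝ) * ((n : ℝ) + m + l + e) ^ (k + 4) := by
  have hn' : (1 : ℝ) ≤ n := by exact_mod_cast hn
  have hm' : (0 : ℝ) ≤ m := by positivity
  set L : ℝ := n + m + l + e with hL
  have hL1 : 1 ≤ L := by linarith
  have hL0 : 0 ≤ L := by linarith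
  have hLk : 1 ≤ L ^ k := one_le_pow₀ hL1
  have hL4 : 1 ≤ L ^ 4 := one_le_pow₀ hL1
  have h2 : (1 : ℝ) ≤ L ^ 2 := one_le_pow₀ hL1
  have h14 : L ≤ L ^ 4 := le_self_pow₀ hL1 (by norm_num)
  have hle : l * e ≤ L * L := mul_le_mul (by linarith) (by linarith) (by linarith) hL0
  have hΦ' : Φ ≤ 4 * L ^ 4 := by
    calc Φ ≤ n * ((m + 1) * (1 + 2 * l * e)) + m := hΦ
      _ ≤ L * (L * (L ^ 2 + 2 * L ^ 2)) + L := by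
          have hle' : 2 * l * e ≤ 2 * L ^ 2 := by nlinarith
          gcongr
          · linarith
          · linarith
          · linarith
      _ = 3 * L ^ 4 + L := by ring
      _ ≤ 4 * L ^ 4 := by linarith
  have hr' : (r : ℝ) + 1 ≤ 6 * L ^ 4 := by linarith
  have hc' : (c : ℝ) ≤ C * L ^ k := by
    calc (c : ℝ) ≤ C * ((n : ℝ) + m + 1) ^ k := by exact_mod_cast hc
      _ ≤ C * L ^ k := by gcongr; linarith
  have ht' : (t : ℝ) ≤ ((r : ℝ) + 1) * (c + 5) + 5 := by exact_mod_cast ht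
  calc (t : ℝ) ≤ ((r : ℝ) + 1) * (c + 5) + 5 := ht'
    _ ≤ (6 * L ^ 4) * (C * L ^ k + 5 * L ^ k) + 5 * (L ^ 4 * L ^ k) := by
        gcongr
        · linarith
        · have := mul_le_mul hL4 hLk (by norm_num) (by positivity)
          linarith
    _ = ((6 * C + 35 : ℕ) : ℝ) * L ^ (k + 4) := by push_cast; ring

end EFX

theorem theorem1 :
    ∃ (c : EFX.Prog) (C k : ℕ),
      ∀ (n m : ℕ) (v : Fin n → Finset (Fin m) → ℝ) (ε W : ℝ),
        0 < n → (∀ i, EFX.IsAdditiveValuation (v i)) → 0 < ε → ε ≤ 1 / 2 → 1 ≤ W →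
        (∀ i g, 0 < v i {g} → v i Finset.univ ≤ W * v i {g}) →
        ∃ (t : ℕ) (s : EFX.Memory),
          EFX.Exec (EFX.instanceInput v ε) c EFX.Memory.init t s ∧
          (t : ℝ) ≤ C * ((n : ℝ) + m + Real.logb 2 W + 1 / ε) ^ k ∧
          EFX.IsPartialAllocation (EFX.outputBundles n m s) ∧
          EFX.outputPool m s = EFX.unallocated (EFX.outputBundles n m s) ∧
          EFX.IsApproxEFX v (1 - ε) (EFX.outputBundles n m s) ∧
          ((EFX.outputPool m s).card : ℝ) ≤ 64 * ((n : ℝ) / ε) ^ ((4 : ℝ) / 5) := by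
  obtain ⟨C, k, hC⟩ := EFX.SProg.round.cost_le_pow
  refine ⟨EFX.algorithm, 6 * C + 35, k + 4, ?_⟩
  intro n m v ε W hn hv h0 h1 hW hWv
  set I := EFX.instanceInput v ε with hI'
  have hI : I.Valid := EFX.instanceInput_valid hn hv h0 h1
  have hWv' : ∀ i < I.numAgents, ∀ g < I.numGoods, 0 < I.value i g →
      I.val i (range I.numGoods) ≤ W * I.value i g := by
    intro i hi g hg hpos
    have h2 : I.val i (range I.numGoods) = v ⟨i, hi⟩ univ := by
      rw [← EFX.val_map (ε := ε) hv ⟨i, hi⟩ univ, Fin.map_valEmbedding_univ, Nat.Iio_eq_range]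
      rfl
    have h3 : I.value i g = v ⟨i, hi⟩ {⟨g, hg⟩} := EFX.instanceInput_value hi hg
    rw [h3] at hpos
    rw [h2, h3]
    exact hWv _ _ hpos
  -- The zero memory encodes the empty allocation, which is trivially fair.
  have hal : EFX.SProg.alloc I EFX.Memory.init = fun _ => ∅ := by
    funext i
    ext g
    simp [EFX.SProg.alloc, EFX.SProg.mem_supp, EFX.Memory.init]
  have hX : EFX.Fair I (EFX.SProg.alloc I EFX.Memory.init) := by
    rw [hal]
    exact ⟨by simp, by simp, by simp⟩
  -- The number of rounds is bounded through the rounded-up potential of the empty allocation.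
  obtain ⟨t, s, he, ht, hfin⟩ := EFX.exec_algorithm hI hW hWv' (N := n + m)
    (Nat.le_add_right n m) (Nat.le_add_left m n) _ EFX.Memory.init hX rfl (Nat.le_ceil _)
  have hdiv : 2 ≤ 1 / ε := by rw [le_div_iff₀ h0]; linarith
  have hpool : EFX.outputPool m s = EFX.unallocated (EFX.outputBundles n m s) := by
    refine map_injective Fin.valEmbedding ?_
    rw [EFX.map_outputPool (v := v) (ε := ε), EFX.map_unallocated (v := v) (ε := ε)]
    exact hfin.pool
  refine ⟨t, s, he, ?_, ?_, hpool, ?_, ?_⟩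
  · refine EFX.steps_le hn (Real.logb_nonneg one_lt_two hW) hdiv ?_
      (Nat.ceil_lt_add_one (EFX.potential_nonneg hI hW hX)).le (hC (n + m)) ht
    rw [hal]
    exact EFX.potential_empty_le hI hW
  · intro i j hij
    rw [← disjoint_map Fin.valEmbedding, EFX.map_outputBundles (v := v) (ε := ε),
      EFX.map_outputBundles (v := v) (ε := ε)]
    exact hfin.fair.disj i i.2 j j.2 fun h => hij (Fin.ext h)
  · intro i j g hg
    have h2 := hfin.fair.efx i i.2 j j.2 g (by
      rw [← EFX.map_outputBundles]
      exact mem_map_of_mem Fin.valEmbedding hg)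
    have h3 : (EFX.SProg.alloc I s j).erase g =
        (EFX.outputBundles n m s j \ {g}).map Fin.valEmbedding := by
      rw [← EFX.map_outputBundles, sdiff_singleton_eq_erase, map_erase]
      rfl
    rw [EFX.Envies, h3, ← EFX.map_outputBundles, EFX.val_map hv, EFX.val_map hv] at h2
    exact not_lt.1 h2
  · rw [hpool, ← card_map Fin.valEmbedding, EFX.map_unallocated (v := v) (ε := ε)]
    exact hfin.card_le
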